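/- Let $X_1,X_2,\ldots$ be i.i.d. real random variables and, for $n\in\mathbb{N}$ independently, let $W_{n1},\ldots,W_{nn}$ be real random variables, independent of $(X_1,X_2,\ldots)$, that are negatively orthant dependent (NOD), i.e. for all $x_1,\ldots,x_n\in\mathbb{R}$, $$\mathbb{P}(W_{n1}\le x_1,\ldots,W_{nn}\le x_n)\le\prod_{j=1}^n\mathbb{P}(W_{nj}\le x_j)\quad\text{and}\quad \mathbb{P}(W_{n1}>x_1,\ldots,W_{nn}>x_n)\le\prod_{j=1}^n\mathbb{P}(W_{nj}>x_j).$$ Let $\Theta$ be a compact subset of a separable metric space with metric $d$, and let $H:\Theta\times\mathbb{R}\to\mathbb{R}$ be such that $\theta\mapsto H(\theta,x)$ is continuous for each $x\in\mathbb{R}$ and $x\mapsto H(\theta,x)$ is measurable for each $\theta\in\Theta$. Let $a>0$ and $D>0$, and assume: (i) there exist $M>0$ and $\delta>0$ such that for all $x\in\mathbb{R}$ and $\theta,\theta'\in\Theta$, if $d(\theta,\theta')<\delta$ then $|H(\theta,x)-H(\theta',x)|\le M\,d(\theta,\theta')^a$; (ii) there exists $c>0$ such that $N(r)\le c\,r^{-D}$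 for all sufficiently small $r>0$, where $N(r)$ is the smallest number of open balls of radius $r$, centered at points in $\Theta$, needed to cover $\Theta$. Let $p\in(1,2)$ and suppose that for some $q>\dfrac{(1-1/p)D/a+1}{1/p-1/2}$, $$\sup_{\theta\in\Theta}\mathbb{E}\big(|H(\theta,X_1)|^q\big)<\infty\quad\text{and}\quad\sum_{j=1}^n\mathbb{E}\big(|W_{nj}|^q\big)=O(n)\ \text{ as } n\to\infty.$$ Then, for all sufficiently large $n$, the variables $W_{nj}H(\theta,X_j)$ ($1\le j\le n$, $\theta\in\Theta$) are integrable, and $$\sup_{\theta\in\Theta}\bigg|\frac{1}{n^{1/p}}\sum_{j=1}^n\Big(W_{nj}H(\theta,X_j)-\mathbb{E}\big(W_{nj}H(\theta,X_j)\big)\Big)\bigg|\xrightarrow[n\to\infty]{\mathrm{a.s.}}0.$$ -/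

import Mathlib

open MeasureTheory ProbabilityTheory Filter Topology
open scoped ENNReal NNReal

/-- A finite collection `Y` of real random variables is negatively orthant dependent (NOD)
under `μ`. -/
def NOD {Ω ι : Type*} [MeasurableSpace Ω] [Fintype ι] (Y : ι → Ω → ℝ) (μ : Measure Ω) : Prop :=
  ∀ x : ι → ℝ,
    μ {ω | ∀ i, Y i ω ≤ x i} ≤ ∏ i, μ {ω | Y i ω ≤ x i} ∧
    μ {ω | ∀ i, x i < Y i ω} ≤ ∏ i, μ {ω | x i < Y i ω}

/-- The covering number `N(r)` of `Θ`: the smallest number of open balls of radius `r`, centered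
at points of `Θ`, needed to cover `Θ` (it is `⊤` if no finite number suffices). -/
noncomputable def openCoveringNumber {S : Type*} [MetricSpace S] (Θ : Set S) (r : ℝ) : ℕ∞ :=
  ⨅ (t : Finset S) (_ : (t : Set S) ⊆ Θ) (_ : Θ ⊆ ⋃ y ∈ t, Metric.ball y r), (t.card : ℕ∞)

/-- `N(r) ≤ c r^{-D}` for some `c > 0` and all sufficiently small radii `r > 0`. (For large `r`
such a bound is impossible when `Θ` is nonempty, as then `N(r) ≥ 1`.) -/
def CoveringNumberBound {S : Type*} [MetricSpace S] (Θ : Set S) (D : ℝ) : Prop :=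
  ∃ c : ℝ, 0 < c ∧ ∃ r₀ : ℝ, 0 < r₀ ∧ ∀ r : ℝ, 0 < r → r ≤ r₀ →
    (openCoveringNumber Θ r : ℝ≥0∞) ≤ ENNReal.ofReal (c * r ^ (-D))

/-- `θ ↦ H(θ, x)` is locally Hölder continuous with exponent `a`, uniformly in `x`. -/
def UniformlyLocallyHolder {S : Type*} [MetricSpace S] {Θ : Set S} (H : Θ → ℝ → ℝ) (a : ℝ) :
    Prop :=
  ∃ M : ℝ, 0 < M ∧ ∃ δ : ℝ, 0 < δ ∧ ∀ (x : ℝ) (θ θ' : Θ), dist θ θ' < δ →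
    |H θ x - H θ' x| ≤ M * dist θ θ' ^ a

/-! Negative orthant dependence gives E ∏ f_j(W_j) ≤ ∏ E f_j(W_j) for nonnegative f_j that are all
nondecreasing or all nonincreasing (`NOD.lintegral_prod_le`). Freezing the X_j extends this to
functions of (W_j, X_j) monotone in the weight (`NOD.lintegral_prod_le_of_indepFun`). Chernoff's
method therefore works as for independent summands and, with truncation from above, yields a
Fuk–Nagaev bound (`measure_sum_ge_le_of_lintegral_prod_le`). When the q-th moments average to O(1),
deviations of size ε n^(1/p) have probability O(n^(-β)) with β = q(1/p - 1/2)
(`exists_measure_sum_ge_rpow_le`). Splitting H(θ, ·) into positive and negative parts restores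
monotonicity in the weight (`NOD.exists_measure_abs_sum_ge_rpow_le`).

For uniformity in θ, take a net of radius n^(-s), with at most c n^(sD) points. The union bound over
it is O(n^(sD-β)), summable if sD < β - 1. Moving θ to a nearby net point costs O(n^(1-sa)) by the
Hölder condition, because ∑|W_nj| = O(n) off a small event (`NOD.exists_measure_sum_abs_ge_le`);
this is o(n^(1/p)) if sa > 1 - 1/p. The lower bound on q says exactly that both conditions on s can
be met, and Borel–Cantelli concludes. -/

/-! ### Product inequalities for negatively orthant dependent variables. -/

/-- The definition of NOD only speaks of rays (a, ∞) and (-∞, a], whereas superlevel sets of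
monotone functions may also be rays with the other endpoint convention, empty, or all of ℝ. Each is
a pointwise limit of admissible rays. -/
theorem IsUpperSet.exists_seq_eventually_lt_iff {U : Set ℝ} (hU : IsUpperSet U) :
    ∃ a : ℕ → ℝ, ∀ y, ∀ᶠ k in atTop, (a k < y ↔ y ∈ U) := by
  rcases U.eq_empty_or_nonempty with rfl | hne
  · refine ⟨fun k => k, fun y => ?_⟩
    filter_upwards [tendsto_natCast_atTop_atTop.eventually_ge_atTop y] with k hk
    simpa using hk
  by_cases hb : BddBelow U
  · by_cases hs : sInf U ∈ U
    · refine ⟨fun k => sInf U - 1 / ((k : ℝ) + 1), fun y => ?_⟩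
      have hlim : Tendsto (fun k : ℕ => sInf U - 1 / ((k : ℝ) + 1)) atTop (𝓝 (sInf U - 0)) :=
        tendsto_const_nhds.sub tendsto_one_div_add_atTop_nhds_zero_nat
      rw [sub_zero] at hlim
      by_cases hy : y ∈ U
      · refine Eventually.of_forall fun k => ⟨fun _ => hy, fun _ => ?_⟩
        have h1 := csInf_le hb hy
        have h2 : 0 < 1 / ((k : ℝ) + 1) := by positivity
        linarith
      · have hlt : y < sInf U := not_le.1 fun h => hy (hU h hs)
        filter_upwards [hlim.eventually_const_lt hlt] with k hk
        exact ⟨fun h => absurd h (not_lt.2 hk.le), fun h => absurd h hy⟩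
    · refine ⟨fun _ => sInf U, fun y => Eventually.of_forall fun _ => ⟨fun h => ?_, fun h => ?_⟩⟩
      · obtain ⟨u, hu, huy⟩ := exists_lt_of_csInf_lt hne h
        exact hU huy.le hu
      · exact lt_of_le_of_ne (csInf_le hb h) fun h' : sInf U = y => hs (h'.symm ▸ h)
  · refine ⟨fun k => -k, fun y => ?_⟩
    have hy : y ∈ U := by
      obtain ⟨u, hu, huy⟩ := not_bddBelow_iff.1 hb y
      exact hU huy.le hu
    filter_upwards [tendsto_natCast_atTop_atTop.eventually_gt_atTop (-y)] with k hk
    exact ⟨fun _ => hy, fun _ => by linarith⟩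

theorem IsLowerSet.exists_seq_eventually_le_iff {U : Set ℝ} (hU : IsLowerSet U) :
    ∃ a : ℕ → ℝ, ∀ y, ∀ᶠ k in atTop, (y ≤ a k ↔ y ∈ U) := by
  obtain ⟨a, ha⟩ := hU.compl.exists_seq_eventually_lt_iff
  refine ⟨a, fun y => (ha y).mono fun k hk => ?_⟩
  rw [← not_lt, hk, Set.mem_compl_iff, not_not]

section

variable {Ω ι : Type*} [MeasurableSpace Ω] {μ : Measure Ω} [IsProbabilityMeasure μ] [Fintype ι]
  {Y : ι → Ω → ℝ}

/-- At each ω the finitely many membership conditions stabilise, so the indicators converge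
pointwise; on a finite measure both sides pass to the limit. -/
theorem measure_forall_mem_le_prod_of_approx (hY : ∀ i, Measurable (Y i)) {U : ι → Set ℝ}
    {V : ℕ → ι → Set ℝ} (hV : ∀ k i, MeasurableSet (V k i))
    (hVU : ∀ i y, ∀ᶠ k in atTop, (y ∈ V k i ↔ y ∈ U i))
    (h : ∀ k, μ {ω | ∀ i, Y i ω ∈ V k i} ≤ ∏ i, μ {ω | Y i ω ∈ V k i}) :
    μ {ω | ∀ i, Y i ω ∈ U i} ≤ ∏ i, μ {ω | Y i ω ∈ U i} := by
  have hm : ∀ k i, MeasurableSet {ω | Y i ω ∈ V k i} := fun k i => hY i (hV k i)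
  refine le_of_tendsto_of_tendsto' (b := atTop)
    (f := fun k => μ {ω | ∀ i, Y i ω ∈ V k i}) (g := fun k => ∏ i, μ {ω | Y i ω ∈ V k i}) ?_ ?_ h
  · refine tendsto_measure_of_tendsto_indicator_of_isFiniteMeasure _ μ (fun k => ?_) fun ω => ?_
    · simp only [Set.ofPred_forall]
      exact MeasurableSet.iInter fun i => hm k i
    · filter_upwards [eventually_all.2 fun i => hVU i (Y i ω)] with k hk
      exact forall_congr' hk
  · refine ENNReal.tendsto_finsetProd_of_ne_top _ (fun i _ => ?_) fun i _ => measure_ne_top _ _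
    exact tendsto_measure_of_tendsto_indicator_of_isFiniteMeasure _ μ (fun k => hm k i)
      fun ω => hVU i (Y i ω)

/-- Negative orthant dependence extends from orthants to products of upper (or lower) sets. -/
theorem NOD.measure_forall_mem_le_prod (h : NOD Y μ) (hY : ∀ i, Measurable (Y i))
    {U : ι → Set ℝ} (hU : (∀ i, IsUpperSet (U i)) ∨ ∀ i, IsLowerSet (U i)) :
    μ {ω | ∀ i, Y i ω ∈ U i} ≤ ∏ i, μ {ω | Y i ω ∈ U i} := by
  rcases hU with hU | hU
  · choose a ha using fun i => (hU i).exists_seq_eventually_lt_iff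
    exact measure_forall_mem_le_prod_of_approx hY (V := fun k i => Set.Ioi (a i k))
      (fun _ _ => measurableSet_Ioi) ha fun k => (h fun i => a i k).2
  · choose a ha using fun i => (hU i).exists_seq_eventually_le_iff
    exact measure_forall_mem_le_prod_of_approx hY (V := fun k i => Set.Iic (a i k))
      (fun _ _ => measurableSet_Iic) ha fun k => (h fun i => a i k).1

theorem monotone_indicator_one {U : Set ℝ} (hU : IsUpperSet U) :
    Monotone (U.indicator (1 : ℝ → ℝ)) := by
  intro x y hxy
  by_cases hx : x ∈ U
  · simp [hx, hU hxy hx]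
  · rw [Set.indicator_of_notMem hx]
    exact Set.indicator_nonneg (fun _ _ => zero_le_one) _

theorem antitone_indicator_one {U : Set ℝ} (hU : IsLowerSet U) :
    Antitone (U.indicator (1 : ℝ → ℝ)) := by
  intro x y hxy
  by_cases hy : y ∈ U
  · simp [hy, hU hxy hy]
  · rw [Set.indicator_of_notMem hy]
    exact Set.indicator_nonneg (fun _ _ => zero_le_one) _

/-- For NOD variables, the expectation of a product of nonnegative functions that are all
monotone (or all antitone) is at most the product of the expectations. -/
theorem NOD.lintegral_prod_le (h : NOD Y μ) (hY : ∀ i, Measurable (Y i)) {f : ι → ℝ → ℝ}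
    (hf0 : ∀ i y, 0 ≤ f i y) (hf : (∀ i, Monotone (f i)) ∨ ∀ i, Antitone (f i)) :
    ∫⁻ ω, ∏ i, ENNReal.ofReal (f i (Y i ω)) ∂μ ≤
      ∏ i, ∫⁻ ω, ENNReal.ofReal (f i (Y i ω)) ∂μ := by
  classical
  -- Induction on a set A containing every coordinate whose function is not yet an indicator. With A
  -- empty the claim is the inequality for upper or lower sets.
  suffices H : ∀ (A : Finset ι) (f : ι → ℝ → ℝ), (∀ i y, 0 ≤ f i y) →
      ((∀ i, Monotone (f i)) ∨ ∀ i, Antitone (f i)) →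
      (∀ i ∉ A, ∃ U : Set ℝ, f i = U.indicator 1) →
      ∫⁻ ω, ∏ i, ENNReal.ofReal (f i (Y i ω)) ∂μ ≤
        ∏ i, ∫⁻ ω, ENNReal.ofReal (f i (Y i ω)) ∂μ from
    H Finset.univ f hf0 hf fun i hi => absurd (Finset.mem_univ i) hi
  have hmeas : ∀ f : ι → ℝ → ℝ, ((∀ i, Monotone (f i)) ∨ ∀ i, Antitone (f i)) →
      ∀ i, Measurable (f i) := fun f hf i => hf.elim (fun h => (h i).measurable)
        fun h => (h i).measurable
  intro A
  induction A using Finset.induction_on with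
  | empty =>
    intro f hf0 hf hU
    choose U hU using fun i => hU i (Finset.notMem_empty i)
    have hmU : ∀ i, MeasurableSet {ω | Y i ω ∈ U i} := fun i => by
      have : U i = f i ⁻¹' {1} := by
        ext y
        by_cases hy : y ∈ U i <;> simp [hU, hy]
      rw [this]
      exact ((hmeas f hf i).comp (hY i)) (measurableSet_singleton 1)
    have hpt : ∀ i ω, ENNReal.ofReal (f i (Y i ω)) = {ω | Y i ω ∈ U i}.indicator 1 ω := by
      intro i ω
      by_cases hy : Y i ω ∈ U i <;> simp [hU, hy]
    have hUU : (∀ i, IsUpperSet (U i)) ∨ ∀ i, IsLowerSet (U i) := by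
      refine hf.imp (fun h i x y hxy hx => ?_) (fun h i x y hxy hx => ?_)
      all_goals
        have := h i hxy
        rw [hU i, Set.indicator_of_mem hx] at this
        by_contra hy
        rw [Set.indicator_of_notMem hy] at this
        norm_num at this
    have hprod : ∀ ω, ∏ i, ENNReal.ofReal (f i (Y i ω)) =
        {ω | ∀ i, Y i ω ∈ U i}.indicator 1 ω := by
      intro ω
      by_cases hω : ∀ i, Y i ω ∈ U i
      · simp [hpt, hω]
      · obtain ⟨i, hi⟩ := not_forall.1 hω
        rw [Set.indicator_of_notMem (s := {ω | ∀ i, Y i ω ∈ U i}) hω]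
        exact Finset.prod_eq_zero (Finset.mem_univ i) (by simp [hpt, hi])
    have hm : MeasurableSet {ω | ∀ i, Y i ω ∈ U i} := by
      simp only [Set.ofPred_forall]
      exact MeasurableSet.iInter hmU
    simp only [hprod]
    simp only [hpt, lintegral_indicator_one hm, lintegral_indicator_one (hmU _)]
    exact h.measure_forall_mem_le_prod hY hUU
  | insert i A hiA ih =>
    intro f hf0 hf hU
    -- The other factors become a density, so the layer-cake formula can be applied to the `i`-th
    -- factor alone. At each level s that factor is replaced by the indicator of {f i > s}, which is
    -- monotone in the same direction, and the induction hypothesis applies.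
    set R : Ω → ℝ≥0∞ := fun ω => ∏ j ∈ Finset.univ.erase i, ENNReal.ofReal (f j (Y j ω)) with hR
    set C : ℝ≥0∞ := ∏ j ∈ Finset.univ.erase i, ∫⁻ ω, ENNReal.ofReal (f j (Y j ω)) ∂μ with hC
    have hfm := hmeas f hf
    have hRm : Measurable R :=
      Finset.measurable_prod _ fun j _ => ((hfm j).comp (hY j)).ennreal_ofReal
    have hfi : Measurable fun ω => f i (Y i ω) := (hfm i).comp (hY i)
    have key : ∀ s : ℝ, (μ.withDensity R) {ω | s < f i (Y i ω)} ≤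
        μ {ω | s < f i (Y i ω)} * C := by
      intro s
      have hms : MeasurableSet {ω | s < f i (Y i ω)} := measurableSet_lt measurable_const hfi
      set g : ι → ℝ → ℝ := Function.update f i ({y | s < f i y}.indicator 1) with hg
      have hgi : g i = {y | s < f i y}.indicator 1 := by simp [hg]
      have hgj : ∀ j, j ≠ i → g j = f j := fun j hj => by simp [hg, hj]
      have hgi' : ∀ ω, ENNReal.ofReal (g i (Y i ω)) = {ω | s < f i (Y i ω)}.indicator 1 ω := by
        intro ω
        by_cases hy : s < f i (Y i ω) <;> simp [hgi, hy]
      have hle := ih g ?_ ?_ ?_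
      · rw [← Finset.mul_prod_erase _ _ (Finset.mem_univ i)] at hle
        simp only [← Finset.mul_prod_erase _ _ (Finset.mem_univ i), hgi'] at hle
        rw [lintegral_indicator_one hms] at hle
        have h1 : ∏ j ∈ Finset.univ.erase i, ∫⁻ ω, ENNReal.ofReal (g j (Y j ω)) ∂μ = C :=
          Finset.prod_congr rfl fun j hj => by rw [hgj j (Finset.ne_of_mem_erase hj)]
        have h2 : ∀ ω, ∏ j ∈ Finset.univ.erase i, ENNReal.ofReal (g j (Y j ω)) = R ω := fun ω =>
          Finset.prod_congr rfl fun j hj => by rw [hgj j (Finset.ne_of_mem_erase hj)]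
        simp only [h1, h2] at hle
        rw [withDensity_apply _ hms, ← lintegral_indicator hms]
        refine le_trans (le_of_eq (lintegral_congr fun ω => ?_)) hle
        by_cases hy : ω ∈ {ω | s < f i (Y i ω)} <;> simp [hy]
      · intro j y
        by_cases hj : j = i
        · subst hj
          rw [hgi]
          exact Set.indicator_nonneg (fun _ _ => zero_le_one) _
        · rw [hgj j hj]
          exact hf0 j y
      · refine hf.imp (fun h j => ?_) (fun h j => ?_)
        all_goals by_cases hj : j = i
        · subst hj
          rw [hgi]
          exact monotone_indicator_one fun x y hxy hx => lt_of_lt_of_le hx (h j hxy)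
        · rw [hgj j hj]
          exact h j
        · subst hj
          rw [hgi]
          exact antitone_indicator_one fun x y hxy hx => lt_of_lt_of_le hx (h j hxy)
        · rw [hgj j hj]
          exact h j
      · intro j hj
        by_cases hji : j = i
        · subst hji
          exact ⟨_, hgi⟩
        · rw [hgj j hji]
          exact hU j (by simp [hji, hj])
    calc ∫⁻ ω, ∏ j, ENNReal.ofReal (f j (Y j ω)) ∂μ
        = ∫⁻ ω, ENNReal.ofReal (f i (Y i ω)) ∂(μ.withDensity R) := by
          rw [lintegral_withDensity_eq_lintegral_mul _ hRm hfi.ennreal_ofReal]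
          refine lintegral_congr fun ω => ?_
          rw [Pi.mul_apply, mul_comm]
          exact (Finset.mul_prod_erase _ (fun j => ENNReal.ofReal (f j (Y j ω)))
            (Finset.mem_univ i)).symm
      _ = ∫⁻ s in Set.Ioi 0, (μ.withDensity R) {ω | s < f i (Y i ω)} :=
          lintegral_eq_lintegral_meas_lt _ (ae_of_all _ fun ω => hf0 i _) hfi.aemeasurable
      _ ≤ ∫⁻ s in Set.Ioi 0, μ {ω | s < f i (Y i ω)} * C := lintegral_mono fun s => key s
      _ = (∫⁻ s in Set.Ioi 0, μ {ω | s < f i (Y i ω)}) * C := by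
          refine lintegral_mul_const _ (Antitone.measurable fun s t hst => ?_)
          exact measure_mono fun ω hω => lt_of_le_of_lt hst hω
      _ = (∫⁻ ω, ENNReal.ofReal (f i (Y i ω)) ∂μ) * C := by
          rw [lintegral_eq_lintegral_meas_lt _ (ae_of_all _ fun ω => hf0 i _) hfi.aemeasurable]
      _ = ∏ j, ∫⁻ ω, ENNReal.ofReal (f j (Y j ω)) ∂μ :=
          Finset.mul_prod_erase _ (fun j => ∫⁻ ω, ENNReal.ofReal (f j (Y j ω)) ∂μ)
            (Finset.mem_univ i)

/-- Tonelli for the joint law, which is a product. It serves to freeze `V` while inequalities are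
applied to `U`. -/
theorem lintegral_comp_prodMk_of_indepFun {β γ : Type*} [MeasurableSpace β] [MeasurableSpace γ]
    {U : Ω → β} {V : Ω → γ} (hU : Measurable U) (hV : Measurable V) (hUV : IndepFun U V μ)
    {g : β → γ → ℝ≥0∞} (hg : Measurable (Function.uncurry g)) :
    ∫⁻ ω, g (U ω) (V ω) ∂μ = ∫⁻ ω, ∫⁻ ω', g (U ω') (V ω) ∂μ ∂μ := by
  have : IsProbabilityMeasure (μ.map U) := Measure.isProbabilityMeasure_map hU.aemeasurable
  have : IsProbabilityMeasure (μ.map V) := Measure.isProbabilityMeasure_map hV.aemeasurable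
  calc ∫⁻ ω, g (U ω) (V ω) ∂μ = ∫⁻ z, Function.uncurry g z ∂(μ.map fun ω => (U ω, V ω)) := by
        rw [lintegral_map hg (hU.prodMk hV)]
        rfl
    _ = ∫⁻ y, ∫⁻ x, g x y ∂(μ.map U) ∂(μ.map V) := by
        rw [(indepFun_iff_map_prod_eq_prod_map_map hU.aemeasurable hV.aemeasurable).1 hUV,
          lintegral_prod_symm' _ hg]
        rfl
    _ = ∫⁻ ω, ∫⁻ ω', g (U ω') (V ω) ∂μ ∂μ := by
        rw [lintegral_map (f := fun y => ∫⁻ x, g x y ∂(μ.map U))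
          (Measurable.lintegral_prod_left' hg) hV]
        refine lintegral_congr fun ω => ?_
        exact lintegral_map (hg.comp measurable_prodMk_right) hU

/-- `NOD.lintegral_prod_le` for functions that also depend on variables `X i` which are
independent of each other and of the NOD family. -/
theorem NOD.lintegral_prod_le_of_indepFun {X : ι → Ω → ℝ} (h : NOD Y μ)
    (hY : ∀ i, Measurable (Y i)) (hX : ∀ i, Measurable (X i)) (hXi : iIndepFun X μ)
    (hYX : IndepFun (fun ω i => Y i ω) (fun ω i => X i ω) μ) {F : ι → ℝ → ℝ → ℝ}
    (hFm : ∀ i, Measurable (Function.uncurry (F i))) (hF0 : ∀ i w x, 0 ≤ F i w x)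
    (hF : (∀ i x, Monotone fun w => F i w x) ∨ ∀ i x, Antitone fun w => F i w x) :
    ∫⁻ ω, ∏ i, ENNReal.ofReal (F i (Y i ω) (X i ω)) ∂μ ≤
      ∏ i, ∫⁻ ω, ENNReal.ofReal (F i (Y i ω) (X i ω)) ∂μ := by
  have hYv : Measurable fun ω i => Y i ω := measurable_pi_lambda _ hY
  have hXv : Measurable fun ω i => X i ω := measurable_pi_lambda _ hX
  have hpair : ∀ i, IndepFun (Y i) (X i) μ := fun i =>
    hYX.comp (measurable_pi_apply i) (measurable_pi_apply i)
  -- `φ i x` is the conditional expectation of the `i`-th factor given `X i = x`. After the NOD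
  -- inequality at frozen `X`, the factors `φ i (X i)` are independent.
  set φ : ι → ℝ → ℝ≥0∞ := fun i x => ∫⁻ ω', ENNReal.ofReal (F i (Y i ω') x) ∂μ with hφ
  have hφm : ∀ i, Measurable (φ i) := fun i => by
    refine Measurable.lintegral_prod_left' (f := fun z : Ω × ℝ => ENNReal.ofReal (F i (Y i z.1) z.2))
      ?_
    exact ((hFm i).comp (((hY i).comp measurable_fst).prodMk measurable_snd)).ennreal_ofReal
  have hgm : Measurable (Function.uncurry fun (w x : ι → ℝ) =>
      ∏ i, ENNReal.ofReal (F i (w i) (x i))) := by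
    refine Finset.measurable_prod _ fun i _ => Measurable.ennreal_ofReal ?_
    have : Measurable fun z : (ι → ℝ) × (ι → ℝ) => (z.1 i, z.2 i) := by fun_prop
    exact (hFm i).comp this
  calc ∫⁻ ω, ∏ i, ENNReal.ofReal (F i (Y i ω) (X i ω)) ∂μ
      = ∫⁻ ω, ∫⁻ ω', ∏ i, ENNReal.ofReal (F i (Y i ω') (X i ω)) ∂μ ∂μ :=
        lintegral_comp_prodMk_of_indepFun hYv hXv hYX hgm
    _ ≤ ∫⁻ ω, ∏ i, φ i (X i ω) ∂μ := by
        refine lintegral_mono fun ω => ?_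
        exact h.lintegral_prod_le hY (f := fun i w => F i w (X i ω)) (fun i w => hF0 i w _)
          (hF.imp (fun h i => h i _) fun h i => h i _)
    _ = ∏ i, ∫⁻ ω, φ i (X i ω) ∂μ :=
        lintegral_prod_eq_prod_lintegral_of_indepFun Finset.univ (fun i ω => φ i (X i ω))
          (hXi.comp φ hφm) fun i => (hφm i).comp (hX i)
    _ = ∏ i, ∫⁻ ω, ENNReal.ofReal (F i (Y i ω) (X i ω)) ∂μ := by
        refine Finset.prod_congr rfl fun i _ => ?_
        exact (lintegral_comp_prodMk_of_indepFun (g := fun w x => ENNReal.ofReal (F i w x))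
          (hY i) (hX i) (hpair i) (hFm i).ennreal_ofReal).symm

end

/-! ### Exponential inequality for truncated sums, and moment bounds. -/

/-- Since exp(-u) ≥ 1 - u, the remainder exp(u) - 1 - u is at most u(exp(u) - 1), which is then
bounded separately for each sign of u. No lower bound on u is needed, so truncation from above will
suffice. -/
theorem Real.exp_le_one_add_self_add_sq_mul_exp {u c : ℝ} (hc : 0 ≤ c) (hu : u ≤ c) :
    Real.exp u ≤ 1 + u + u ^ 2 * Real.exp c := by
  have h1 : Real.exp u - 1 - u ≤ u * (Real.exp u - 1) := by
    have h := Real.add_one_le_exp (-u)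
    have h2 : Real.exp (-u) * Real.exp u = 1 := by rw [← Real.exp_add]; simp
    nlinarith [Real.exp_pos u]
  have h3 : u * (Real.exp u - 1) ≤ u ^ 2 * Real.exp c := by
    rcases le_total 0 u with h0 | h0
    · have h4 : Real.exp u - 1 ≤ u * Real.exp u := by linarith
      have h5 : Real.exp u ≤ Real.exp c := Real.exp_le_exp.2 hu
      calc u * (Real.exp u - 1) ≤ u * (u * Real.exp u) := by gcongr
        _ = u ^ 2 * Real.exp u := by ring
        _ ≤ u ^ 2 * Real.exp c := by gcongr
    · have h4 := Real.add_one_le_exp u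
      have h5 : 1 ≤ Real.exp c := Real.one_le_exp hc
      nlinarith [mul_nonneg (neg_nonneg.2 h0) (sub_nonneg.2 h4), mul_nonneg (sq_nonneg u)
        (sub_nonneg.2 h5)]
  linarith

theorem MeasureTheory.MemLp.integrable_abs_rpow {Ω : Type*} [MeasurableSpace Ω] {μ : Measure Ω}
    {Z : Ω → ℝ} {q : ℝ} (hZ : MemLp Z (ENNReal.ofReal q) μ) (hq : 0 < q) : Integrable (fun ω => |Z ω| ^ q) μ := by
  have := hZ.integrable_norm_rpow (by simpa using hq) ENNReal.ofReal_ne_top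
  simpa [ENNReal.toReal_ofReal hq.le] using this

theorem memLp_of_lintegral_abs_rpow {Ω : Type*} [MeasurableSpace Ω] {μ : Measure Ω}
    {Z : Ω → ℝ} (hZm : Measurable Z) {q : ℝ} (hq : 0 < q)
    (hZ : ∫⁻ ω, ENNReal.ofReal (|Z ω| ^ q) ∂μ ≠ ∞) : MemLp Z (ENNReal.ofReal q) μ := by
  rw [← integrable_norm_rpow_iff hZm.aestronglyMeasurable (by simpa using hq)
    ENNReal.ofReal_ne_top, ENNReal.toReal_ofReal hq.le]
  have hm : Measurable fun ω => |Z ω| ^ q := hZm.abs.pow_const q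
  refine ⟨hm.aestronglyMeasurable, ?_⟩
  rw [hasFiniteIntegral_iff_ofReal (ae_of_all _ fun ω => by positivity)]
  exact lt_top_iff_ne_top.2 hZ

section

variable {Ω ι : Type*} [MeasurableSpace Ω] {μ : Measure Ω} [IsProbabilityMeasure μ] [Fintype ι]

/-- One-sided truncation needs no recentring: min(Z, y) ≤ Z keeps the mean of the linear term at
most 0, and min(Z, y)² ≤ Z² because y > 0. -/
theorem lintegral_exp_mul_min_le {Z : Ω → ℝ} (hZ : MemLp Z 2 μ) (hZ0 : ∫ ω, Z ω ∂μ = 0)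
    {y c : ℝ} (hy : 0 < y) (hc : 0 ≤ c) :
    ∫⁻ ω, ENNReal.ofReal (Real.exp (c / y * min (Z ω) y)) ∂μ ≤
      ENNReal.ofReal (Real.exp ((c / y) ^ 2 * Real.exp c * ∫ ω, Z ω ^ 2 ∂μ)) := by
  have hint : Integrable Z μ := hZ.integrable (by norm_num)
  have hint2 : Integrable (fun ω => Z ω ^ 2) μ := hZ.integrable_sq
  have ht : 0 ≤ c / y := by positivity
  have hpt : ∀ ω, Real.exp (c / y * min (Z ω) y) ≤
      1 + c / y * Z ω + (c / y) ^ 2 * Real.exp c * Z ω ^ 2 := by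
    intro ω
    have hu : c / y * min (Z ω) y ≤ c := by
      calc c / y * min (Z ω) y ≤ c / y * y := by gcongr; exact min_le_right _ _
        _ = c := by field_simp
    refine (Real.exp_le_one_add_self_add_sq_mul_exp hc hu).trans ?_
    have h1 : c / y * min (Z ω) y ≤ c / y * Z ω := by gcongr; exact min_le_left _ _
    have h2 : min (Z ω) y ^ 2 ≤ Z ω ^ 2 := by
      rcases min_cases (Z ω) y with ⟨h, -⟩ | ⟨h, h'⟩ <;> rw [h]
      nlinarith
    have h3 : (c / y * min (Z ω) y) ^ 2 * Real.exp c ≤ (c / y) ^ 2 * Real.exp c * Z ω ^ 2 := by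
      rw [mul_pow]
      calc (c / y) ^ 2 * min (Z ω) y ^ 2 * Real.exp c
          ≤ (c / y) ^ 2 * Z ω ^ 2 * Real.exp c := by gcongr
        _ = _ := by ring
    linarith
  have hI : Integrable (fun ω => 1 + c / y * Z ω + (c / y) ^ 2 * Real.exp c * Z ω ^ 2) μ :=
    ((integrable_const _).add (hint.const_mul _)).add (hint2.const_mul _)
  calc ∫⁻ ω, ENNReal.ofReal (Real.exp (c / y * min (Z ω) y)) ∂μ
      ≤ ∫⁻ ω, ENNReal.ofReal (1 + c / y * Z ω + (c / y) ^ 2 * Real.exp c * Z ω ^ 2) ∂μ :=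
        lintegral_mono fun ω => ENNReal.ofReal_le_ofReal (hpt ω)
    _ = ENNReal.ofReal (∫ ω, (1 + c / y * Z ω + (c / y) ^ 2 * Real.exp c * Z ω ^ 2) ∂μ) :=
        (ofReal_integral_eq_lintegral_ofReal hI
          (ae_of_all _ fun ω => (Real.exp_pos _).le.trans (hpt ω))).symm
    _ ≤ _ := by
        refine ENNReal.ofReal_le_ofReal ?_
        rw [integral_add (f := fun ω => 1 + c / y * Z ω)
            ((integrable_const _).add (hint.const_mul _)) (hint2.const_mul _),
          integral_add (integrable_const _) (hint.const_mul _), integral_const_mul,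
          integral_const_mul, hZ0]
        have := Real.add_one_le_exp ((c / y) ^ 2 * Real.exp c * ∫ ω, Z ω ^ 2 ∂μ)
        simp
        linarith

/-- A Fuk–Nagaev type inequality: it needs only that the exponential moments of the sum of the
truncated variables are dominated by those of independent variables. -/
theorem measure_sum_ge_le_of_lintegral_prod_le {Z : ι → Ω → ℝ} (hZm : ∀ i, Measurable (Z i))
    (hZ : ∀ i, MemLp (Z i) 2 μ) (hZ0 : ∀ i, ∫ ω, Z i ω ∂μ = 0) {y c : ℝ} (hy : 0 < y)
    (hc : 0 ≤ c)
    (hprod : ∫⁻ ω, ∏ i, ENNReal.ofReal (Real.exp (c / y * min (Z i ω) y)) ∂μ ≤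
      ∏ i, ∫⁻ ω, ENNReal.ofReal (Real.exp (c / y * min (Z i ω) y)) ∂μ) (x : ℝ) :
    μ {ω | x ≤ ∑ i, Z i ω} ≤ ∑ i, μ {ω | y ≤ Z i ω} +
      ENNReal.ofReal (Real.exp (-(c / y * x) +
        (c / y) ^ 2 * Real.exp c * ∑ i, ∫ ω, Z i ω ^ 2 ∂μ)) := by
  have ht : 0 ≤ c / y := by positivity
  set B := {ω | ENNReal.ofReal (Real.exp (c / y * x)) ≤
    ∏ i, ENNReal.ofReal (Real.exp (c / y * min (Z i ω) y))} with hB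
  -- Unless some `Z i` reaches y, truncation changes nothing and the event lies in the Chernoff
  -- event `B`.
  have hsub : {ω | x ≤ ∑ i, Z i ω} ⊆ (⋃ i ∈ Finset.univ, {ω | y ≤ Z i ω}) ∪ B := by
    intro ω hω
    by_cases h : ∃ i, y ≤ Z i ω
    · obtain ⟨i, hi⟩ := h
      exact Or.inl (Set.mem_biUnion (Finset.mem_univ i) hi)
    · push Not at h
      refine Or.inr ?_
      have h1 : ∀ i, min (Z i ω) y = Z i ω := fun i => min_eq_left (h i).le
      simp only [hB, Set.mem_ofPred_eq, h1]
      rw [← ENNReal.ofReal_prod_of_nonneg fun i _ => (Real.exp_pos _).le, ← Real.exp_sum,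
        ← Finset.mul_sum]
      refine ENNReal.ofReal_le_ofReal (Real.exp_le_exp.2 ?_)
      exact mul_le_mul_of_nonneg_left hω ht
  have hBm : Measurable fun ω => ∏ i, ENNReal.ofReal (Real.exp (c / y * min (Z i ω) y)) :=
    Finset.measurable_prod _ fun i _ => by
      have := hZm i
      fun_prop
  have hpos : ENNReal.ofReal (Real.exp (c / y * x)) ≠ 0 := by simp [Real.exp_pos]
  have hμB : μ B ≤ ENNReal.ofReal (Real.exp (-(c / y * x) +
      (c / y) ^ 2 * Real.exp c * ∑ i, ∫ ω, Z i ω ^ 2 ∂μ)) := by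
    refine (meas_ge_le_lintegral_div hBm.aemeasurable hpos ENNReal.ofReal_ne_top).trans ?_
    rw [ENNReal.div_le_iff hpos ENNReal.ofReal_ne_top, ← ENNReal.ofReal_mul (Real.exp_pos _).le,
      ← Real.exp_add]
    calc _ ≤ ∏ i, ∫⁻ ω, ENNReal.ofReal (Real.exp (c / y * min (Z i ω) y)) ∂μ := hprod
      _ ≤ ∏ i, ENNReal.ofReal (Real.exp ((c / y) ^ 2 * Real.exp c * ∫ ω, Z i ω ^ 2 ∂μ)) :=
        Finset.prod_le_prod' fun i _ => lintegral_exp_mul_min_le (hZ i) (hZ0 i) hy hc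
      _ = _ := by
        rw [← ENNReal.ofReal_prod_of_nonneg fun i _ => (Real.exp_pos _).le, ← Real.exp_sum,
          ← Finset.mul_sum]
        congr 2
        ring
  calc μ {ω | x ≤ ∑ i, Z i ω} ≤ μ ((⋃ i ∈ Finset.univ, {ω | y ≤ Z i ω}) ∪ B) :=
        measure_mono hsub
    _ ≤ μ (⋃ i ∈ Finset.univ, {ω | y ≤ Z i ω}) + μ B := measure_union_le _ _
    _ ≤ _ := add_le_add (measure_biUnion_finset_le _ _) hμB

/-- Jensen bounds |E Z|^q by E|Z|^q, and |u - v|^q ≤ 2^q (|u|^q + |v|^q). -/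
theorem integral_abs_sub_integral_rpow_le {Z : Ω → ℝ} {q : ℝ} (hq : 1 ≤ q)
    (hZ : MemLp Z (ENNReal.ofReal q) μ) :
    ∫ ω, |Z ω - ∫ ω', Z ω' ∂μ| ^ q ∂μ ≤ 2 ^ (q + 1) * ∫ ω, |Z ω| ^ q ∂μ := by
  have hq0 : 0 < q := by linarith
  have hint : Integrable Z μ := hZ.integrable (by simpa using hq)
  have hI := hZ.integrable_abs_rpow hq0
  set m := ∫ ω', Z ω' ∂μ with hm
  have hmq : |m| ^ q ≤ ∫ ω, |Z ω| ^ q ∂μ := by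
    have h1 : |m| ≤ ∫ ω, |Z ω| ∂μ := abs_integral_le_integral_abs
    have h2 : (∫ ω, |Z ω| ∂μ) ^ q ≤ ∫ ω, |Z ω| ^ q ∂μ :=
      (convexOn_rpow hq).map_integral_le (Real.continuous_rpow_const hq0.le).continuousOn
        isClosed_Ici (ae_of_all _ fun ω => Set.mem_Ici.2 (abs_nonneg _)) hint.abs hI
    exact (Real.rpow_le_rpow (abs_nonneg _) h1 hq0.le).trans h2
  have hpt : ∀ ω, |Z ω - m| ^ q ≤ 2 ^ q * (|Z ω| ^ q + |m| ^ q) := by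
    intro ω
    have h1 : |Z ω - m| ≤ 2 * max |Z ω| |m| := by
      have := abs_sub (Z ω) m
      have h2 := le_max_left |Z ω| |m|
      have h3 := le_max_right |Z ω| |m|
      linarith
    refine (Real.rpow_le_rpow (abs_nonneg _) h1 hq0.le).trans ?_
    rw [Real.mul_rpow zero_le_two (le_max_of_le_left (abs_nonneg _))]
    gcongr
    rcases max_cases |Z ω| |m| with ⟨h, -⟩ | ⟨h, -⟩ <;> rw [h]
    · exact le_add_of_nonneg_right (by positivity)
    · exact le_add_of_nonneg_left (by positivity)
  have hI2 := (hZ.sub (memLp_const m)).integrable_abs_rpow hq0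
  calc ∫ ω, |Z ω - m| ^ q ∂μ ≤ ∫ ω, 2 ^ q * (|Z ω| ^ q + |m| ^ q) ∂μ :=
        integral_mono hI2 ((hI.add (integrable_const _)).const_mul _) hpt
    _ = 2 ^ q * (∫ ω, |Z ω| ^ q ∂μ + |m| ^ q) := by
        rw [integral_const_mul, integral_add hI (integrable_const _)]
        simp
    _ ≤ 2 ^ q * (∫ ω, |Z ω| ^ q ∂μ + ∫ ω, |Z ω| ^ q ∂μ) := by gcongr
    _ = _ := by
        rw [Real.rpow_add_one two_ne_zero]
        ring

theorem measure_ge_le_integral_abs_rpow_div {Z : Ω → ℝ} {q : ℝ} (hq : 0 < q)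
    (hZ : MemLp Z (ENNReal.ofReal q) μ) {y : ℝ} (hy : 0 < y) :
    μ {ω | y ≤ Z ω} ≤ ENNReal.ofReal ((∫ ω, |Z ω| ^ q ∂μ) / y ^ q) := by
  have hI := hZ.integrable_abs_rpow hq
  have hyq : 0 < y ^ q := by positivity
  have h := mul_meas_ge_le_integral_of_nonneg (ae_of_all μ fun ω => by positivity) hI (y ^ q)
  rw [← ofReal_measureReal]
  refine ENNReal.ofReal_le_ofReal ?_
  rw [le_div_iff₀ hyq, mul_comm]
  refine le_trans ?_ h
  refine mul_le_mul_of_nonneg_left (measureReal_mono (fun ω hω => ?_)) hyq.le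
  have hω' : y ≤ Z ω := hω
  exact Real.rpow_le_rpow hy.le (hω'.trans (le_abs_self _)) hq.le

end

/-! ### Polynomial tail bounds for sums with NOD weights. -/

theorem sq_le_one_add_abs_rpow (z : ℝ) {q : ℝ} (hq : 2 ≤ q) : z ^ 2 ≤ 1 + |z| ^ q := by
  rw [← sq_abs]
  rcases le_total |z| 1 with h | h
  · have h1 : |z| ^ 2 ≤ 1 := pow_le_one₀ (abs_nonneg _) h
    have h2 : 0 ≤ |z| ^ q := by positivity
    linarith
  · have h1 : |z| ^ (2 : ℝ) ≤ |z| ^ q := Real.rpow_le_rpow_of_exponent_le h hq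
    rw [Real.rpow_two] at h1
    linarith

theorem abs_le_one_add_abs_rpow (z : ℝ) {q : ℝ} (hq : 1 ≤ q) : |z| ≤ 1 + |z| ^ q := by
  rcases le_total |z| 1 with h | h
  · have h2 : 0 ≤ |z| ^ q := by positivity
    linarith
  · have h1 : |z| ^ (1 : ℝ) ≤ |z| ^ q := Real.rpow_le_rpow_of_exponent_le h hq
    rw [Real.rpow_one] at h1
    linarith

theorem integrable_of_memLp_ofReal {Ω : Type*} [MeasurableSpace Ω] {μ : Measure Ω}
    [IsProbabilityMeasure μ] {Z : Ω → ℝ} {q : ℝ} (hq : 1 ≤ q)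
    (hZ : MemLp Z (ENNReal.ofReal q) μ) : Integrable Z μ :=
  hZ.integrable (by simpa using hq)

section

variable {Ω : Type*} [MeasurableSpace Ω] (μ : Measure Ω) [IsProbabilityMeasure μ]

/-- Polynomial tail bound for normalized sums, uniform over all families with a given bound on
the average `q`-th moment. -/
theorem exists_measure_sum_ge_rpow_le {p q C ε : ℝ} (hp : 0 < p) (hp' : p < 2) (hq : 2 ≤ q)
    (hC : 0 ≤ C) (hε : 0 < ε) :
    ∃ K : ℝ, 0 ≤ K ∧ ∀ n : ℕ, 0 < n → ∀ Z : Fin n → Ω → ℝ, (∀ j, Measurable (Z j)) →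
      (∀ j, MemLp (Z j) (ENNReal.ofReal q) μ) → (∀ j, ∫ ω, Z j ω ∂μ = 0) →
      (∑ j, ∫ ω, |Z j ω| ^ q ∂μ ≤ C * n) →
      (∀ t y : ℝ, 0 ≤ t → ∫⁻ ω, ∏ j, ENNReal.ofReal (Real.exp (t * min (Z j ω) y)) ∂μ ≤
        ∏ j, ∫⁻ ω, ENNReal.ofReal (Real.exp (t * min (Z j ω) y)) ∂μ) →
      μ {ω | ε * (n : ℝ) ^ (1 / p) ≤ ∑ j, Z j ω} ≤
        ENNReal.ofReal (K * (n : ℝ) ^ (-(q * (1 / p - 1 / 2)))) := by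
  have hq0 : 0 < q := by linarith
  -- The first summand comes from Markov's inequality at the truncation level, the second from the
  -- Chernoff term.
  refine ⟨C * (q / ε) ^ q + Real.exp (2 * (q / ε) ^ 2 * (1 + C)), by positivity, ?_⟩
  intro n hn Z hZm hZ hZ0 hZq hprod
  have hn1 : (1 : ℝ) ≤ n := by exact_mod_cast hn
  have hn0 : (0 : ℝ) < n := by linarith
  set N : ℝ := (n : ℝ) with hN
  set x := ε * N ^ (1 / p) with hx
  have hx0 : 0 < x := by positivity
  -- With y = x/q the Chernoff factor exp(-(c/y)x) is exp(-cq). The logarithmic c below makes it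
  -- n^(-q(1/p-1/2)), while the variance term stays bounded: c² ≤ 2 exp(c) and exp(2c) n = n^(2/p),
  -- which x² cancels.
  set y := x / q with hy
  have hy0 : 0 < y := by positivity
  set c := (1 / p - 1 / 2) * Real.log N with hc
  have hl : 0 ≤ 1 / p - 1 / 2 := by
    have := one_div_le_one_div_of_le hp hp'.le
    linarith
  have hc0 : 0 ≤ c := mul_nonneg hl (Real.log_nonneg hn1)
  have hec : Real.exp c = N ^ (1 / p - 1 / 2) := by
    rw [Real.rpow_def_of_pos hn0, hc, mul_comm]
  have h2 : ENNReal.ofReal 2 ≤ ENNReal.ofReal q := ENNReal.ofReal_le_ofReal hq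
  have hZ2 : ∀ j, MemLp (Z j) 2 μ := fun j => (hZ j).mono_exponent (by simpa using h2)
  have hsq : ∑ j, ∫ ω, Z j ω ^ 2 ∂μ ≤ (1 + C) * N := by
    calc ∑ j, ∫ ω, Z j ω ^ 2 ∂μ ≤ ∑ j, (1 + ∫ ω, |Z j ω| ^ q ∂μ) := by
          refine Finset.sum_le_sum fun j _ => ?_
          have hI := (hZ j).integrable_abs_rpow hq0
          calc ∫ ω, Z j ω ^ 2 ∂μ ≤ ∫ ω, (1 + |Z j ω| ^ q) ∂μ :=
                integral_mono (hZ2 j).integrable_sq ((integrable_const _).add hI)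
                  fun ω => sq_le_one_add_abs_rpow _ hq
            _ = _ := by rw [integral_add (integrable_const _) hI]; simp
      _ = N + ∑ j, ∫ ω, |Z j ω| ^ q ∂μ := by rw [Finset.sum_add_distrib]; simp [hN]
      _ ≤ N + C * N := by gcongr
      _ = _ := by ring
  refine (measure_sum_ge_le_of_lintegral_prod_le hZm hZ2 hZ0 hy0 hc0
    (hprod _ _ (by positivity)) x).trans ?_
  have hexp : -(c / y * x) + (c / y) ^ 2 * Real.exp c * ∑ j, ∫ ω, Z j ω ^ 2 ∂μ ≤
      -(c * q) + 2 * (q / ε) ^ 2 * (1 + C) := by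
    have h1 : c / y * x = c * q := by rw [hy]; field_simp
    have h3 : c ^ 2 ≤ 2 * Real.exp c := by
      have := Real.quadratic_le_exp_of_nonneg hc0
      linarith
    have h4 : Real.exp c ^ 2 * N = (N ^ (1 / p)) ^ 2 := by
      rw [hec, ← Real.rpow_natCast, ← Real.rpow_natCast, ← Real.rpow_mul hn0.le,
        ← Real.rpow_mul hn0.le, ← Real.rpow_add_one hn0.ne']
      congr 1
      push_cast
      ring
    rw [h1]
    refine add_le_add_right ?_ _
    calc (c / y) ^ 2 * Real.exp c * ∑ j, ∫ ω, Z j ω ^ 2 ∂μ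
        ≤ (c / y) ^ 2 * Real.exp c * ((1 + C) * N) := by gcongr
      _ = c ^ 2 * (q / x) ^ 2 * Real.exp c * ((1 + C) * N) := by rw [hy]; field_simp
      _ ≤ 2 * Real.exp c * (q / x) ^ 2 * Real.exp c * ((1 + C) * N) := by gcongr
      _ = 2 * (q / x) ^ 2 * (1 + C) * (Real.exp c ^ 2 * N) := by ring
      _ = _ := by rw [h4, hx]; field_simp
  have hfirst : ∑ j, μ {ω | y ≤ Z j ω} ≤
      ENNReal.ofReal (C * (q / ε) ^ q * N ^ (-(q * (1 / p - 1 / 2)))) := by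
    calc ∑ j, μ {ω | y ≤ Z j ω}
        ≤ ∑ j, ENNReal.ofReal ((∫ ω, |Z j ω| ^ q ∂μ) / y ^ q) :=
          Finset.sum_le_sum fun j _ => measure_ge_le_integral_abs_rpow_div hq0 (hZ j) hy0
      _ = ENNReal.ofReal ((∑ j, ∫ ω, |Z j ω| ^ q ∂μ) / y ^ q) := by
          rw [Finset.sum_div, ENNReal.ofReal_sum_of_nonneg]
          intro j _
          have : 0 ≤ ∫ ω, |Z j ω| ^ q ∂μ := integral_nonneg fun ω => by positivity
          positivity
      _ ≤ _ := by
          refine ENNReal.ofReal_le_ofReal ?_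
          calc (∑ j, ∫ ω, |Z j ω| ^ q ∂μ) / y ^ q ≤ C * N / y ^ q := by gcongr
            _ = C * (q / ε) ^ q * (N / (N ^ (1 / p)) ^ q) := by
                rw [hy, hx, Real.div_rpow (by positivity) hq0.le,
                  Real.mul_rpow hε.le (by positivity), Real.div_rpow hq0.le hε.le]
                field_simp
            _ ≤ _ := by
                gcongr
                rw [← Real.rpow_mul hn0.le]
                nth_rewrite 1 [← Real.rpow_one N]
                rw [← Real.rpow_sub hn0]
                -- The exponent comparison 1 - q/p ≤ q/2 - q/p is where q ≥ 2 enters.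
                refine Real.rpow_le_rpow_of_exponent_le hn1 ?_
                have : 1 / p * q = q * (1 / p) := mul_comm _ _
                linarith
  have hsecond : ENNReal.ofReal (Real.exp (-(c / y * x) +
      (c / y) ^ 2 * Real.exp c * ∑ j, ∫ ω, Z j ω ^ 2 ∂μ)) ≤
      ENNReal.ofReal (Real.exp (2 * (q / ε) ^ 2 * (1 + C)) * N ^ (-(q * (1 / p - 1 / 2)))) := by
    refine ENNReal.ofReal_le_ofReal ((Real.exp_le_exp.2 hexp).trans (le_of_eq ?_))
    rw [Real.exp_add, mul_comm, Real.rpow_def_of_pos hn0, hc]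
    congr 2
    ring
  refine (add_le_add hfirst hsecond).trans (le_of_eq ?_)
  rw [← ENNReal.ofReal_add (by positivity) (by positivity), ← add_mul]

/-- Independence factors the q-th moment of the dominating product |W| |h(X)|. A general `G` is
allowed so that signed parts of the product are covered too. -/
theorem memLp_and_integral_abs_rpow_le_of_indepFun {Ω : Type*} [MeasurableSpace Ω]
    {μ : Measure Ω} {W X : Ω → ℝ} (hW : Measurable W)
    (hX : Measurable X) (hWX : IndepFun W X μ) {q : ℝ} (hq : 0 < q) {h : ℝ → ℝ}
    (hh : Measurable h) {G : ℝ → ℝ → ℝ} (hG : Measurable (Function.uncurry G))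
    (hGh : ∀ w x, |G w x| ≤ |w| * |h x|) (hWq : ∫⁻ ω, ENNReal.ofReal (|W ω| ^ q) ∂μ ≠ ∞)
    {B : ℝ≥0} (hB : ∫⁻ ω, ENNReal.ofReal (|h (X ω)| ^ q) ∂μ ≤ B) :
    MemLp (fun ω => G (W ω) (X ω)) (ENNReal.ofReal q) μ ∧
      ENNReal.ofReal (∫ ω, |G (W ω) (X ω)| ^ q ∂μ) ≤
        (∫⁻ ω, ENNReal.ofReal (|W ω| ^ q) ∂μ) * B := by
  have hm : Measurable fun ω => G (W ω) (X ω) := hG.comp (hW.prodMk hX)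
  have hle : ∫⁻ ω, ENNReal.ofReal (|G (W ω) (X ω)| ^ q) ∂μ ≤
      (∫⁻ ω, ENNReal.ofReal (|W ω| ^ q) ∂μ) * B := by
    have hφ : Measurable fun w : ℝ => ENNReal.ofReal (|w| ^ q) :=
      (measurable_id.abs.pow_const q).ennreal_ofReal
    have hψ : Measurable fun x : ℝ => ENNReal.ofReal (|h x| ^ q) :=
      (hh.abs.pow_const q).ennreal_ofReal
    calc ∫⁻ ω, ENNReal.ofReal (|G (W ω) (X ω)| ^ q) ∂μ
        ≤ ∫⁻ ω, ((fun w : ℝ => ENNReal.ofReal (|w| ^ q)) ∘ W *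
            (fun x : ℝ => ENNReal.ofReal (|h x| ^ q)) ∘ X) ω ∂μ := by
          refine lintegral_mono fun ω => ?_
          simp only [Pi.mul_apply, Function.comp_apply]
          rw [← ENNReal.ofReal_mul (by positivity), ← Real.mul_rpow (abs_nonneg _) (abs_nonneg _)]
          exact ENNReal.ofReal_le_ofReal (Real.rpow_le_rpow (abs_nonneg _) (hGh _ _) hq.le)
      _ = (∫⁻ ω, ENNReal.ofReal (|W ω| ^ q) ∂μ) * ∫⁻ ω, ENNReal.ofReal (|h (X ω)| ^ q) ∂μ :=
          lintegral_mul_eq_lintegral_mul_lintegral_of_indepFun (hφ.comp hW) (hψ.comp hX)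
            (hWX.comp hφ hψ)
      _ ≤ _ := by gcongr
  have hL : MemLp (fun ω => G (W ω) (X ω)) (ENNReal.ofReal q) μ :=
    memLp_of_lintegral_abs_rpow hm hq
      (ne_top_of_le_ne_top (ENNReal.mul_ne_top hWq ENNReal.coe_ne_top) hle)
  refine ⟨hL, ?_⟩
  rwa [ofReal_integral_eq_lintegral_ofReal (hL.integrable_abs_rpow hq)
    (ae_of_all _ fun ω => by positivity)]

/-- The tail bound for sums of `G (W j) (X j)`, where `W` is NOD, the `X j` are independent of
each other and of `W`, and `G` is monotone (or antitone) in its first argument. -/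
theorem NOD.exists_measure_sum_ge_rpow_le {p q ε : ℝ} (hp : 0 < p) (hp' : p < 2) (hq : 2 ≤ q)
    (C B : ℝ≥0) (hε : 0 < ε) :
    ∃ K : ℝ, 0 ≤ K ∧ ∀ n : ℕ, 0 < n → ∀ W X : Fin n → Ω → ℝ, NOD W μ →
      (∀ j, Measurable (W j)) → (∀ j, Measurable (X j)) → iIndepFun X μ →
      IndepFun (fun ω j => W j ω) (fun ω j => X j ω) μ →
      ∑ j, ∫⁻ ω, ENNReal.ofReal (|W j ω| ^ q) ∂μ ≤ C * n →
      ∀ h : ℝ → ℝ, Measurable h → (∀ j, ∫⁻ ω, ENNReal.ofReal (|h (X j ω)| ^ q) ∂μ ≤ B) →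
      ∀ G : ℝ → ℝ → ℝ, Measurable (Function.uncurry G) → (∀ w x, |G w x| ≤ |w| * |h x|) →
      ((∀ x, Monotone fun w => G w x) ∨ ∀ x, Antitone fun w => G w x) →
      μ {ω | ε * (n : ℝ) ^ (1 / p) ≤
        ∑ j, (G (W j ω) (X j ω) - ∫ ω', G (W j ω') (X j ω') ∂μ)} ≤
        ENNReal.ofReal (K * (n : ℝ) ^ (-(q * (1 / p - 1 / 2)))) := by
  have hq0 : 0 < q := by linarith
  have hq1 : 1 ≤ q := by linarith
  obtain ⟨K, hK0, hK⟩ := _root_.exists_measure_sum_ge_rpow_le μ (C := 2 ^ (q + 1) * (C * B))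
    hp hp' hq (by positivity) hε
  refine ⟨K, hK0, ?_⟩
  intro n hn W X hnod hW hX hXi hWX hWq h hh hB G hG hGh hmono
  have hWfin : ∀ j, ∫⁻ ω, ENNReal.ofReal (|W j ω| ^ q) ∂μ ≠ ∞ := fun j =>
    ne_top_of_le_ne_top (ENNReal.mul_ne_top ENNReal.coe_ne_top (ENNReal.natCast_ne_top n))
      ((Finset.single_le_sum (f := fun j => ∫⁻ ω, ENNReal.ofReal (|W j ω| ^ q) ∂μ)
        (fun _ _ => zero_le) (Finset.mem_univ j)).trans hWq)
  have hmom := fun j => memLp_and_integral_abs_rpow_le_of_indepFun (hW j) (hX j)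
    (hWX.comp (measurable_pi_apply j) (measurable_pi_apply j)) hq0 hh hG hGh (hWfin j) (hB j)
  have hYm : ∀ j, Measurable fun ω => G (W j ω) (X j ω) := fun j =>
    hG.comp ((hW j).prodMk (hX j))
  have hint : ∀ j, Integrable (fun ω => G (W j ω) (X j ω)) μ := fun j =>
    integrable_of_memLp_ofReal hq1 (hmom j).1
  refine hK n hn (fun j ω => G (W j ω) (X j ω) - ∫ ω', G (W j ω') (X j ω') ∂μ)
    (fun j => (hYm j).sub_const _) (fun j => (hmom j).1.sub (memLp_const _)) (fun j => ?_) ?_ ?_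
  · rw [integral_sub (hint j) (integrable_const _)]
    simp
  · have hsum : ∑ j, ∫ ω, |G (W j ω) (X j ω)| ^ q ∂μ ≤ C * B * n := by
      have h0 : ∀ j, 0 ≤ ∫ ω, |G (W j ω) (X j ω)| ^ q ∂μ := fun j =>
        integral_nonneg fun ω => by positivity
      rw [← ENNReal.ofReal_le_ofReal_iff (by positivity),
        ENNReal.ofReal_sum_of_nonneg fun j _ => h0 j]
      calc ∑ j, ENNReal.ofReal (∫ ω, |G (W j ω) (X j ω)| ^ q ∂μ)
          ≤ ∑ j, (∫⁻ ω, ENNReal.ofReal (|W j ω| ^ q) ∂μ) * B :=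
            Finset.sum_le_sum fun j _ => (hmom j).2
        _ = (∑ j, ∫⁻ ω, ENNReal.ofReal (|W j ω| ^ q) ∂μ) * B := by rw [Finset.sum_mul]
        _ ≤ C * n * B := by gcongr
        _ = ENNReal.ofReal (C * B * n) := by
            rw [ENNReal.ofReal_mul (by positivity), ENNReal.ofReal_mul (by positivity)]
            simp only [ENNReal.ofReal_coe_nnreal, ENNReal.ofReal_natCast]
            ring
    calc _ ≤ ∑ j, 2 ^ (q + 1) * ∫ ω, |G (W j ω) (X j ω)| ^ q ∂μ :=
          Finset.sum_le_sum fun j _ => integral_abs_sub_integral_rpow_le hq1 (hmom j).1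
      _ = 2 ^ (q + 1) * ∑ j, ∫ ω, |G (W j ω) (X j ω)| ^ q ∂μ := by rw [Finset.mul_sum]
      _ ≤ 2 ^ (q + 1) * (C * B * n) := by gcongr
      _ = _ := by ring
  · intro t y ht
    -- Centring, truncating from above, scaling by t ≥ 0 and exponentiating are all nondecreasing,
    -- so each factor inherits the direction of monotonicity of `G`.
    refine hnod.lintegral_prod_le_of_indepFun hW hX hXi hWX
      (F := fun j w x => Real.exp (t * min (G w x - ∫ ω', G (W j ω') (X j ω') ∂μ) y))
      (fun j => ?_) (fun _ _ _ => (Real.exp_pos _).le) (hmono.imp (fun hm j x w w' hw => ?_)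
        fun hm j x w w' hw => ?_)
    · exact (((hG.sub_const _).min measurable_const).const_mul t).exp
    · have := hm x hw
      dsimp only at this ⊢
      gcongr
    · have := hm x hw
      dsimp only at this ⊢
      gcongr

end

theorem ENNReal.ofReal_four_mul {K x : ℝ} : ENNReal.ofReal (4 * K * x) =
    ENNReal.ofReal (K * x) + ENNReal.ofReal (K * x) +
      (ENNReal.ofReal (K * x) + ENNReal.ofReal (K * x)) := by
  rw [mul_assoc, ENNReal.ofReal_mul (by norm_num)]
  norm_num
  ring

section

variable {Ω : Type*} [MeasurableSpace Ω] (μ : Measure Ω) [IsProbabilityMeasure μ]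

/-- Two-sided tail bound for weighted sums of `h (X j)` with NOD weights. -/
theorem NOD.exists_measure_abs_sum_ge_rpow_le {p q ε : ℝ} (hp : 0 < p) (hp' : p < 2)
    (hq : 2 ≤ q) (C B : ℝ≥0) (hε : 0 < ε) :
    ∃ K : ℝ, 0 ≤ K ∧ ∀ n : ℕ, 0 < n → ∀ W X : Fin n → Ω → ℝ, NOD W μ →
      (∀ j, Measurable (W j)) → (∀ j, Measurable (X j)) → iIndepFun X μ →
      IndepFun (fun ω j => W j ω) (fun ω j => X j ω) μ →
      ∑ j, ∫⁻ ω, ENNReal.ofReal (|W j ω| ^ q) ∂μ ≤ C * n →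
      ∀ h : ℝ → ℝ, Measurable h → (∀ j, ∫⁻ ω, ENNReal.ofReal (|h (X j ω)| ^ q) ∂μ ≤ B) →
      μ {ω | 2 * ε * (n : ℝ) ^ (1 / p) ≤
        |∑ j, (W j ω * h (X j ω) - ∫ ω', W j ω' * h (X j ω') ∂μ)|} ≤
        ENNReal.ofReal (4 * K * (n : ℝ) ^ (-(q * (1 / p - 1 / 2)))) := by
  obtain ⟨K, hK0, hK⟩ := NOD.exists_measure_sum_ge_rpow_le μ hp hp' hq C B hε
  refine ⟨K, hK0, ?_⟩
  intro n hn W X hnod hW hX hXi hWX hWq h hh hB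
  have hq0 : 0 < q := by linarith
  have hq1 : 1 ≤ q := by linarith
  have hWfin : ∀ j, ∫⁻ ω, ENNReal.ofReal (|W j ω| ^ q) ∂μ ≠ ∞ := fun j =>
    ne_top_of_le_ne_top (ENNReal.mul_ne_top ENNReal.coe_ne_top (ENNReal.natCast_ne_top n))
      ((Finset.single_le_sum (f := fun j => ∫⁻ ω, ENNReal.ofReal (|W j ω| ^ q) ∂μ)
        (fun _ _ => zero_le) (Finset.mem_univ j)).trans hWq)
  have hint : ∀ G : ℝ → ℝ → ℝ, Measurable (Function.uncurry G) →
      (∀ w x, |G w x| ≤ |w| * |h x|) → ∀ j, Integrable (fun ω => G (W j ω) (X j ω)) μ :=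
    fun G hG hGh j => integrable_of_memLp_ofReal hq1
      (memLp_and_integral_abs_rpow_le_of_indepFun (hW j) (hX j)
        (hWX.comp (measurable_pi_apply j) (measurable_pi_apply j)) hq0 hh hG hGh
        (hWfin j) (hB j)).1
  have hbound := hK n hn W X hnod hW hX hXi hWX hWq h hh hB
  -- The direction of w ↦ w h(x) depends on the sign of h(x), so h is split into positive and
  -- negative parts. Each part needs an upper and a lower bound: four one-sided estimates, hence 4K,
  -- and two deviations of size ε, hence 2ε.
  set P : ℝ → ℝ → ℝ := fun w x => w * max (h x) 0 with hP
  set Q : ℝ → ℝ → ℝ := fun w x => w * max (-h x) 0 with hQ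
  have hPm : Measurable (Function.uncurry P) :=
    measurable_fst.mul ((hh.comp measurable_snd).max measurable_const)
  have hQm : Measurable (Function.uncurry Q) :=
    measurable_fst.mul ((hh.comp measurable_snd).neg.max measurable_const)
  have hPh : ∀ w x, |P w x| ≤ |w| * |h x| := fun w x => by
    rw [hP, abs_mul]
    refine mul_le_mul_of_nonneg_left ?_ (abs_nonneg _)
    rw [abs_of_nonneg (le_max_right _ _)]
    exact max_le (le_abs_self _) (abs_nonneg _)
  have hQh : ∀ w x, |Q w x| ≤ |w| * |h x| := fun w x => by
    rw [hQ, abs_mul]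
    refine mul_le_mul_of_nonneg_left ?_ (abs_nonneg _)
    rw [abs_of_nonneg (le_max_right _ _)]
    exact max_le (neg_le_abs _) (abs_nonneg _)
  have hPmono : ∀ x, Monotone fun w => P w x := fun x w w' hw =>
    mul_le_mul_of_nonneg_right hw (le_max_right _ _)
  have hQmono : ∀ x, Monotone fun w => Q w x := fun x w w' hw =>
    mul_le_mul_of_nonneg_right hw (le_max_right _ _)
  have e1 := hbound P hPm hPh (Or.inl hPmono)
  have e2 := hbound Q hQm hQh (Or.inl hQmono)
  have e3 := hbound (fun w x => -P w x) hPm.neg (fun w x => by rw [abs_neg]; exact hPh w x)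
    (Or.inr fun x => (hPmono x).neg)
  have e4 := hbound (fun w x => -Q w x) hQm.neg (fun w x => by rw [abs_neg]; exact hQh w x)
    (Or.inr fun x => (hQmono x).neg)
  have hdec : ∀ w x, w * h x = P w x - Q w x := fun w x => by
    simp only [hP, hQ, ← mul_sub]
    congr 1
    rcases le_total 0 (h x) with h0 | h0
    · rw [max_eq_left h0, max_eq_right (by linarith)]; ring
    · rw [max_eq_right h0, max_eq_left (by linarith)]; ring
  have hIP := hint P hPm hPh
  have hIQ := hint Q hQm hQh
  rw [ENNReal.ofReal_four_mul]
  refine le_trans ?_ ((measure_union_le _ _).trans (add_le_add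
    ((measure_union_le _ _).trans (add_le_add e1 e2))
    ((measure_union_le _ _).trans (add_le_add e3 e4))))
  refine measure_mono fun ω hω => ?_
  by_contra hcon
  simp only [Set.mem_union, Set.mem_ofPred_eq, not_or, not_le, integral_neg, sub_neg_eq_add,
    neg_add_eq_sub] at hcon hω
  obtain ⟨⟨h1, h2⟩, h3, h4⟩ := hcon
  have hs : ∑ j, (W j ω * h (X j ω) - ∫ ω', W j ω' * h (X j ω') ∂μ) =
      ∑ j, (P (W j ω) (X j ω) - ∫ ω', P (W j ω') (X j ω') ∂μ) -
        ∑ j, (Q (W j ω) (X j ω) - ∫ ω', Q (W j ω') (X j ω') ∂μ) := by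
    rw [← Finset.sum_sub_distrib]
    refine Finset.sum_congr rfl fun j _ => ?_
    simp only [hdec]
    rw [integral_sub (hIP j) (hIQ j)]
    ring
  have hneg : ∀ G : ℝ → ℝ → ℝ, ∑ j, (∫ ω', G (W j ω') (X j ω') ∂μ - G (W j ω) (X j ω)) =
      -∑ j, (G (W j ω) (X j ω) - ∫ ω', G (W j ω') (X j ω') ∂μ) := fun G => by
    rw [← Finset.sum_neg_distrib]
    simp
  rw [hneg P] at h3
  rw [hneg Q] at h4
  rw [hs] at hω
  have : |∑ j, (P (W j ω) (X j ω) - ∫ ω', P (W j ω') (X j ω') ∂μ) -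
        ∑ j, (Q (W j ω) (X j ω) - ∫ ω', Q (W j ω') (X j ω') ∂μ)| <
      2 * ε * (n : ℝ) ^ (1 / p) := abs_lt.2 ⟨by linarith, by linarith⟩
  linarith

theorem sum_integral_abs_le {q : ℝ} (hq : 1 ≤ q) {C : ℝ≥0} {n : ℕ} {W : Fin n → Ω → ℝ}
    (hW : ∀ j, Measurable (W j))
    (hWq : ∑ j, ∫⁻ ω, ENNReal.ofReal (|W j ω| ^ q) ∂μ ≤ C * n) :
    (∀ j, Integrable (W j) μ) ∧ ∑ j, ∫ ω, |W j ω| ∂μ ≤ (1 + C) * n := by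
  have hq0 : 0 < q := by linarith
  have hfin : ∀ j, ∫⁻ ω, ENNReal.ofReal (|W j ω| ^ q) ∂μ ≠ ∞ := fun j =>
    ne_top_of_le_ne_top (ENNReal.mul_ne_top ENNReal.coe_ne_top (ENNReal.natCast_ne_top n))
      ((Finset.single_le_sum (f := fun j => ∫⁻ ω, ENNReal.ofReal (|W j ω| ^ q) ∂μ)
        (fun _ _ => zero_le) (Finset.mem_univ j)).trans hWq)
  have hL : ∀ j, MemLp (W j) (ENNReal.ofReal q) μ := fun j =>
    memLp_of_lintegral_abs_rpow (hW j) hq0 (hfin j)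
  have hI := fun j => integrable_of_memLp_ofReal hq (hL j)
  refine ⟨hI, ?_⟩
  have hIq := fun j => (hL j).integrable_abs_rpow hq0
  have hsum : ∑ j, ∫ ω, |W j ω| ^ q ∂μ ≤ C * n := by
    rw [← ENNReal.ofReal_le_ofReal_iff (by positivity), ENNReal.ofReal_sum_of_nonneg fun j _ =>
      integral_nonneg fun ω => by positivity]
    calc _ = ∑ j, ∫⁻ ω, ENNReal.ofReal (|W j ω| ^ q) ∂μ :=
          Finset.sum_congr rfl fun j _ => ofReal_integral_eq_lintegral_ofReal (hIq j)
            (ae_of_all _ fun ω => by positivity)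
      _ ≤ C * n := hWq
      _ = _ := by
          rw [ENNReal.ofReal_mul (by positivity), ENNReal.ofReal_coe_nnreal,
            ENNReal.ofReal_natCast]
  calc ∑ j, ∫ ω, |W j ω| ∂μ ≤ ∑ j, (1 + ∫ ω, |W j ω| ^ q ∂μ) := by
        refine Finset.sum_le_sum fun j _ => ?_
        calc ∫ ω, |W j ω| ∂μ ≤ ∫ ω, (1 + |W j ω| ^ q) ∂μ :=
              integral_mono (hI j).abs ((integrable_const _).add (hIq j))
                fun ω => abs_le_one_add_abs_rpow _ hq
          _ = _ := by rw [integral_add (integrable_const _) (hIq j)]; simp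
    _ = n + ∑ j, ∫ ω, |W j ω| ^ q ∂μ := by rw [Finset.sum_add_distrib]; simp
    _ ≤ n + C * n := by gcongr
    _ = _ := by ring

/-- The average of the absolute weights is bounded up to an event of polynomially small
probability. -/
theorem NOD.exists_measure_sum_abs_ge_le {p q : ℝ} (hp : 1 ≤ p) (hp' : p < 2)
    (hq : 2 ≤ q) (C : ℝ≥0) :
    ∃ K : ℝ, 0 ≤ K ∧ ∀ n : ℕ, 0 < n → ∀ W X : Fin n → Ω → ℝ, NOD W μ →
      (∀ j, Measurable (W j)) → (∀ j, Measurable (X j)) → iIndepFun X μ →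
      IndepFun (fun ω j => W j ω) (fun ω j => X j ω) μ →
      ∑ j, ∫⁻ ω, ENNReal.ofReal (|W j ω| ^ q) ∂μ ≤ C * n →
      μ {ω | (3 + C) * (n : ℝ) ≤ ∑ j, |W j ω|} ≤
        ENNReal.ofReal (4 * K * (n : ℝ) ^ (-(q * (1 / p - 1 / 2)))) := by
  obtain ⟨K, hK0, hK⟩ :=
    NOD.exists_measure_sum_ge_rpow_le μ (by linarith) hp' hq C 1 (zero_lt_one' ℝ)
  refine ⟨K, hK0, ?_⟩
  intro n hn W X hnod hW hX hXi hWX hWq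
  have hbound := hK n hn W X hnod hW hX hXi hWX hWq (fun _ => 1) measurable_const
    fun j => by simp
  obtain ⟨hI, hsum⟩ := sum_integral_abs_le μ (by linarith) hW hWq
  -- With h = 1 and ε = 1, the positive part of w is monotone and the negative part antitone. Each
  -- sum deviates upwards by less than n^(1/p) ≤ n; adding the mean bound (1 + C) n gives the
  -- threshold (3 + C) n.
  have e1 := hbound (fun w _ => max w 0) (measurable_fst.max measurable_const)
    (fun w x => by
      rw [abs_of_nonneg (le_max_right _ _), abs_one, mul_one]
      exact max_le (le_abs_self _) (abs_nonneg _))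
    (Or.inl fun x w w' hw => max_le_max hw le_rfl)
  have e2 := hbound (fun w _ => max (-w) 0) (measurable_fst.neg.max measurable_const)
    (fun w x => by
      rw [abs_of_nonneg (le_max_right _ _), abs_one, mul_one]
      exact max_le (neg_le_abs _) (abs_nonneg _))
    (Or.inr fun x w w' hw => max_le_max (neg_le_neg hw) le_rfl)
  rw [ENNReal.ofReal_four_mul]
  refine le_trans ?_ ((measure_union_le _ _).trans ((add_le_add e1 e2).trans le_self_add))
  refine measure_mono fun ω hω => ?_
  by_contra hcon
  simp only [Set.mem_union, Set.mem_ofPred_eq, not_or, not_le, one_mul] at hcon hω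
  obtain ⟨h1, h2⟩ := hcon
  have hn1 : (1 : ℝ) ≤ n := by exact_mod_cast hn
  have hnp : (n : ℝ) ^ (1 / p) ≤ n := by
    calc (n : ℝ) ^ (1 / p) ≤ (n : ℝ) ^ (1 : ℝ) := Real.rpow_le_rpow_of_exponent_le hn1
          ((div_le_one (by linarith)).2 hp)
      _ = n := Real.rpow_one _
  have habs : ∀ w : ℝ, |w| = max w 0 + max (-w) 0 := fun w => by
    rcases le_total 0 w with h0 | h0
    · rw [abs_of_nonneg h0, max_eq_left h0, max_eq_right (by linarith)]; ring
    · rw [abs_of_nonpos h0, max_eq_right h0, max_eq_left (by linarith)]; ring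
  have hs : ∑ j, |W j ω| - ∑ j, ∫ ω', |W j ω'| ∂μ =
      ∑ j, (max (W j ω) 0 - ∫ ω', max (W j ω') 0 ∂μ) +
        ∑ j, (max (-W j ω) 0 - ∫ ω', max (-W j ω') 0 ∂μ) := by
    rw [← Finset.sum_sub_distrib, ← Finset.sum_add_distrib]
    refine Finset.sum_congr rfl fun j _ => ?_
    simp only [habs]
    rw [integral_add (hI j).pos_part (hI j).neg_part]
    ring
  linarith

end

/-! ### Nets, Borel–Cantelli and the discretization error. -/

/-- A bound on the covering numbers gives nets in `Θ` of controlled size. -/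
theorem CoveringNumberBound.exists_net {S : Type*} [MetricSpace S] {Θ : Set S} {D : ℝ}
    (h : CoveringNumberBound Θ D) :
    ∃ c : ℝ, 0 < c ∧ ∃ r₀ : ℝ, 0 < r₀ ∧ ∀ r : ℝ, 0 < r → r ≤ r₀ →
      ∃ T : Finset Θ, (T.card : ℝ) ≤ c * r ^ (-D) ∧ ∀ θ : Θ, ∃ θ' ∈ T, dist θ θ' < r := by
  classical
  obtain ⟨c, hc, r₀, hr₀, h⟩ := h
  refine ⟨c, hc, r₀, hr₀, fun r hr hrr => ?_⟩
  have hN := h r hr hrr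
  have hfin : openCoveringNumber Θ r ≠ ⊤ := fun htop => by
    rw [htop] at hN
    simp at hN
  -- The infimum is finite and integer-valued, so any cover with fewer than N(r) + 1 balls is
  -- optimal.
  have hlt : openCoveringNumber Θ r < openCoveringNumber Θ r + 1 :=
    (ENat.lt_add_one_iff hfin).2 le_rfl
  nth_rewrite 1 [openCoveringNumber] at hlt
  simp only [iInf_lt_iff] at hlt
  obtain ⟨t, htΘ, hcov, hcard⟩ := hlt
  have hle : (t.card : ℕ∞) ≤ openCoveringNumber Θ r := (ENat.lt_add_one_iff hfin).1 hcard
  refine ⟨t.subtype (· ∈ Θ), ?_, fun θ => ?_⟩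
  · have h1 : ((t.card : ℕ∞) : ℝ≥0∞) ≤ ENNReal.ofReal (c * r ^ (-D)) :=
      (ENat.toENNReal_le.2 hle).trans hN
    have h2 : (t.card : ℝ) ≤ c * r ^ (-D) := by
      rw [← ENNReal.ofReal_le_ofReal_iff (by positivity), ENNReal.ofReal_natCast]
      simpa using h1
    refine le_trans ?_ h2
    rw [Finset.card_subtype]
    exact_mod_cast Finset.card_filter_le _ _
  · obtain ⟨y, hy, hyr⟩ := Set.mem_iUnion₂.1 (hcov θ.2)
    exact ⟨⟨y, htΘ hy⟩, by simpa using hy, hyr⟩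

/-- Borel–Cantelli for the shifted sequence, since the summable bound holds only from some index on.
-/
theorem ae_eventually_notMem_of_measure_le_rpow {Ω : Type*} [MeasurableSpace Ω] {μ : Measure Ω}
    {s : ℕ → Set Ω} {K e : ℝ} (hK : 0 ≤ K) (he : 1 < e)
    (h : ∀ᶠ n in atTop, μ (s n) ≤ ENNReal.ofReal (K * (n : ℝ) ^ (-e))) :
    ∀ᵐ ω ∂μ, ∀ᶠ n in atTop, ω ∉ s n := by
  obtain ⟨N, hN⟩ := eventually_atTop.1 h
  have hsum : Summable fun n : ℕ => K * ((n + N : ℕ) : ℝ) ^ (-e) :=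
    ((summable_nat_add_iff N).2 (Real.summable_nat_rpow.2 (neg_lt_neg he))).mul_left K
  have hne : ∑' n, μ (s (n + N)) ≠ ∞ := by
    refine ne_top_of_le_ne_top ?_ (ENNReal.tsum_le_tsum fun n => hN (n + N) (Nat.le_add_left N n))
    rw [← ENNReal.ofReal_tsum_of_nonneg (fun n => by positivity) hsum]
    exact ENNReal.ofReal_ne_top
  filter_upwards [ae_eventually_notMem hne] with ω hω
  obtain ⟨M, hM⟩ := eventually_atTop.1 hω
  refine eventually_atTop.2 ⟨M + N, fun n hn => ?_⟩
  have := hM (n - N) (by omega)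
  rwa [Nat.sub_add_cancel (by omega)] at this

/-- The cost of replacing a parameter by a net point: an error b in each factor is weighted by |W j|
in the sum and by E|W j| in the centring. -/
theorem abs_sum_sub_integral_le_of_abs_sub_le {Ω ι : Type*} [MeasurableSpace Ω] {μ : Measure Ω}
    [Fintype ι] {W U V : ι → Ω → ℝ} {b : ℝ} (hW : ∀ j, Integrable (W j) μ)
    (hU : ∀ j, Integrable (fun ω => W j ω * U j ω) μ)
    (hV : ∀ j, Integrable (fun ω => W j ω * V j ω) μ)
    (hUV : ∀ j ω, |U j ω - V j ω| ≤ b) (ω : Ω) :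
    |∑ j, (W j ω * U j ω - ∫ ω', W j ω' * U j ω' ∂μ)| ≤
      |∑ j, (W j ω * V j ω - ∫ ω', W j ω' * V j ω' ∂μ)| +
        (∑ j, |W j ω| + ∑ j, ∫ ω', |W j ω'| ∂μ) * b := by
  have hpt : ∀ j ω, |W j ω * U j ω - W j ω * V j ω| ≤ |W j ω| * b := fun j ω => by
    rw [← mul_sub, abs_mul]
    exact mul_le_mul_of_nonneg_left (hUV j ω) (abs_nonneg _)
  have hj : ∀ j, |(W j ω * U j ω - ∫ ω', W j ω' * U j ω' ∂μ) -
      (W j ω * V j ω - ∫ ω', W j ω' * V j ω' ∂μ)| ≤ (|W j ω| + ∫ ω', |W j ω'| ∂μ) * b := by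
    intro j
    have h1 : |∫ ω', W j ω' * U j ω' ∂μ - ∫ ω', W j ω' * V j ω' ∂μ| ≤ (∫ ω', |W j ω'| ∂μ) * b := by
      rw [← integral_sub (hU j) (hV j), ← integral_mul_const]
      exact abs_integral_le_integral_abs.trans
        (integral_mono ((hU j).sub (hV j)).abs ((hW j).abs.mul_const b) (hpt j))
    calc _ = |(W j ω * U j ω - W j ω * V j ω) -
          (∫ ω', W j ω' * U j ω' ∂μ - ∫ ω', W j ω' * V j ω' ∂μ)| := by congr 1; ring
      _ ≤ |W j ω| * b + (∫ ω', |W j ω'| ∂μ) * b :=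
          (abs_sub _ _).trans (add_le_add (hpt j ω) h1)
      _ = _ := by ring
  have h2 : |∑ j, (W j ω * U j ω - ∫ ω', W j ω' * U j ω' ∂μ) -
      ∑ j, (W j ω * V j ω - ∫ ω', W j ω' * V j ω' ∂μ)| ≤
      (∑ j, |W j ω| + ∑ j, ∫ ω', |W j ω'| ∂μ) * b := by
    rw [← Finset.sum_sub_distrib, ← Finset.sum_add_distrib, Finset.sum_mul]
    exact (Finset.abs_sum_le_sum_abs _ _).trans (Finset.sum_le_sum fun j _ => hj j)
  have h3 := abs_sub_abs_le_abs_sub (∑ j, (W j ω * U j ω - ∫ ω', W j ω' * U j ω' ∂μ))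
    (∑ j, (W j ω * V j ω - ∫ ω', W j ω' * V j ω' ∂μ))
  linarith

/-! ### The uniform strong law. -/

theorem theorem3
    {Ω : Type*} [MeasurableSpace Ω] (μ : Measure Ω) [IsProbabilityMeasure μ]
    {S : Type*} [MetricSpace S] [TopologicalSpace.SeparableSpace S]
    (Θ : Set S) (hΘ : IsCompact Θ)
    (H : Θ → ℝ → ℝ)
    (hH_cont : ∀ x : ℝ, Continuous fun θ : Θ => H θ x)
    (hH_meas : ∀ θ : Θ, Measurable (H θ))
    -- the i.i.d. sequence; `X 0, X 1, …` are the variables `X_1, X_2, …`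
    (X : ℕ → Ω → ℝ)
    (hX_meas : ∀ j, Measurable (X j))
    (hX_indep : iIndepFun X μ)
    (hX_ident : ∀ j, IdentDistrib (X j) (X 0) μ μ)
    -- the triangular array of weights; row `n` has `n` entries
    (W : (n : ℕ) → Fin n → Ω → ℝ)
    (hW_meas : ∀ n j, Measurable (W n j))
    (hW_nod : ∀ n, NOD (W n) μ)
    (hW_rows : iIndepFun (fun (n : ℕ) (ω : Ω) (j : Fin n) => W n j ω) μ)
    (hWX : ∀ n, IndepFun (fun (ω : Ω) (j : Fin n) => W n j ω) (fun (ω : Ω) (j : ℕ) => X j ω) μ)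
    (a D p q : ℝ) (ha : 0 < a) (hD : 0 < D) (hp : 1 < p) (hp' : p < 2)
    (hH_holder : UniformlyLocallyHolder H a)
    (hΘ_cov : CoveringNumberBound Θ D)
    (hq : ((1 - 1 / p) * D / a + 1) / (1 / p - 1 / 2) < q)
    (hH_moment : ⨆ θ : Θ, ∫⁻ ω, ENNReal.ofReal (|H θ (X 0 ω)| ^ q) ∂μ < ∞)
    (hW_moment : ∃ C : ℝ≥0, ∀ᶠ n : ℕ in atTop,
      ∑ j : Fin n, ∫⁻ ω, ENNReal.ofReal (|W n j ω| ^ q) ∂μ ≤ C * n) :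
    -- the expectations in the centering exist
    (∀ᶠ n : ℕ in atTop, ∀ (j : Fin n) (θ : Θ), Integrable (fun ω => W n j ω * H θ (X j ω)) μ) ∧
    ∀ᵐ ω ∂μ, Tendsto
      (fun n : ℕ => ⨆ θ : Θ, ENNReal.ofReal
        |1 / (n : ℝ) ^ (1 / p) *
          ∑ j : Fin n, (W n j ω * H θ (X j ω) - ∫ ω', W n j ω' * H θ (X j ω') ∂μ)|)
      atTop (𝓝 0) := by
  obtain ⟨C, hC⟩ := hW_moment
  obtain ⟨M, hM, δ, hδ, hHol⟩ := hH_holder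
  obtain ⟨c, hc, r₀, hr₀, hnet⟩ := hΘ_cov.exists_net
  have hp0 : 0 < p := by linarith
  have hinv : 1 / p < 1 := (div_lt_one hp0).2 hp
  have hl : 0 < 1 / p - 1 / 2 := sub_pos.2 (one_div_lt_one_div_of_lt hp0 hp')
  have hgap0 : 0 ≤ (1 - 1 / p) * D / a := by
    have : 0 ≤ 1 - 1 / p := by linarith
    positivity
  have hq0 : 0 < q := lt_of_le_of_lt (by positivity) hq
  rw [div_lt_iff₀ hl] at hq
  -- The hypothesis gives q(1/p - 1/2) > 1, and 1/p - 1/2 < 1/2 because p > 1.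
  have hq2 : 2 ≤ q := by nlinarith
  have hq1 : 1 ≤ q := by linarith
  set β := q * (1 / p - 1 / 2) with hβ
  obtain ⟨s, hs0, hsa, hsD⟩ : ∃ s : ℝ, 0 < s ∧ 1 - 1 / p < s * a ∧ s * D < β - 1 := by
    set g := β - 1 - (1 - 1 / p) * D / a with hg
    have hg0 : 0 < g := by linarith
    -- The midpoint of the interval from (1 - 1/p)/a to (β - 1)/D.
    refine ⟨(1 - 1 / p) / a + g / (2 * D), ?_, ?_, ?_⟩
    · have : 0 < 1 - 1 / p := by linarith
      positivity
    · have h1 : ((1 - 1 / p) / a + g / (2 * D)) * a = (1 - 1 / p) + g * a / (2 * D) := by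
        field_simp
      have h2 : 0 < g * a / (2 * D) := by positivity
      linarith
    · have h1 : ((1 - 1 / p) / a + g / (2 * D)) * D = (1 - 1 / p) * D / a + g / 2 := by
        field_simp
      linarith
  obtain ⟨B, hB⟩ : ∃ B : ℝ≥0, ∀ (θ : Θ) (j : ℕ),
      ∫⁻ ω, ENNReal.ofReal (|H θ (X j ω)| ^ q) ∂μ ≤ B := by
    refine ⟨(⨆ θ : Θ, ∫⁻ ω, ENNReal.ofReal (|H θ (X 0 ω)| ^ q) ∂μ).toNNReal, fun θ j => ?_⟩
    rw [ENNReal.coe_toNNReal hH_moment.ne]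
    have hm : Measurable fun x => ENNReal.ofReal (|H θ x| ^ q) :=
      ((hH_meas θ).abs.pow_const q).ennreal_ofReal
    have heq : ∫⁻ ω, ENNReal.ofReal (|H θ (X j ω)| ^ q) ∂μ =
        ∫⁻ ω, ENNReal.ofReal (|H θ (X 0 ω)| ^ q) ∂μ := ((hX_ident j).comp hm).lintegral_eq
    rw [heq]
    exact le_iSup (fun θ : Θ => ∫⁻ ω, ENNReal.ofReal (|H θ (X 0 ω)| ^ q) ∂μ) θ
  have hXi : ∀ n : ℕ, iIndepFun (fun (j : Fin n) => X j) μ := fun n =>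
    hX_indep.precomp Fin.val_injective
  have hWXn : ∀ n : ℕ, IndepFun (fun ω (j : Fin n) => W n j ω) (fun ω (j : Fin n) => X j ω) μ :=
    fun n => (hWX n).comp measurable_id
      (measurable_pi_lambda (fun (x : ℕ → ℝ) (j : Fin n) => x j) fun j => measurable_pi_apply _)
  have hint : ∀ n : ℕ, ∑ j : Fin n, ∫⁻ ω, ENNReal.ofReal (|W n j ω| ^ q) ∂μ ≤ C * n →
      ∀ (j : Fin n) (θ : Θ), Integrable (fun ω => W n j ω * H θ (X j ω)) μ := by
    intro n hn j θ
    have hfin : ∫⁻ ω, ENNReal.ofReal (|W n j ω| ^ q) ∂μ ≠ ∞ :=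
      ne_top_of_le_ne_top (ENNReal.mul_ne_top ENNReal.coe_ne_top (ENNReal.natCast_ne_top n))
        ((Finset.single_le_sum (f := fun j => ∫⁻ ω, ENNReal.ofReal (|W n j ω| ^ q) ∂μ)
          (fun _ _ => zero_le) (Finset.mem_univ j)).trans hn)
    exact integrable_of_memLp_ofReal hq1 (memLp_and_integral_abs_rpow_le_of_indepFun
      (G := fun w x => w * H θ x) (hW_meas n j) (hX_meas j)
      ((hWXn n).comp (measurable_pi_apply j) (measurable_pi_apply j)) hq0 (hH_meas θ)
      (measurable_fst.mul ((hH_meas θ).comp measurable_snd)) (fun w x => (abs_mul _ _).le)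
      hfin (hB θ j)).1
  refine ⟨hC.mono hint, ?_⟩
  have hnet' : ∀ n : ℕ, ∃ T : Finset Θ, 0 < n → (n : ℝ) ^ (-s) ≤ r₀ →
      (T.card : ℝ) ≤ c * (n : ℝ) ^ (s * D) ∧ ∀ θ : Θ, ∃ θ' ∈ T, dist θ θ' < (n : ℝ) ^ (-s) := by
    intro n
    by_cases h : 0 < n ∧ (n : ℝ) ^ (-s) ≤ r₀
    · have hn0 : (0 : ℝ) < n := by exact_mod_cast h.1
      obtain ⟨T, hT, hT'⟩ := hnet _ (by positivity) h.2
      refine ⟨T, fun _ _ => ⟨?_, hT'⟩⟩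
      rwa [← Real.rpow_mul hn0.le, neg_mul_neg] at hT
    -- The net is irrelevant for the finitely many n whose radius exceeds `r₀`.
    · exact ⟨∅, fun h1 h2 => absurd ⟨h1, h2⟩ h⟩
  choose T hT using hnet'
  have hrlim : Tendsto (fun n : ℕ => (n : ℝ) ^ (-s)) atTop (𝓝 0) :=
    (tendsto_rpow_neg_atTop hs0).comp tendsto_natCast_atTop_atTop
  -- Of the 3ε, 2ε is the fluctuation at a net point and ε the discretization error.
  have key : ∀ ε : ℝ, 0 < ε → ∀ᵐ ω ∂μ, ∀ᶠ n : ℕ in atTop, ∀ θ : Θ,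
      |1 / (n : ℝ) ^ (1 / p) *
          ∑ j : Fin n, (W n j ω * H θ (X j ω) - ∫ ω', W n j ω' * H θ (X j ω') ∂μ)| ≤ 3 * ε := by
    intro ε hε
    obtain ⟨K₁, hK₁, h₁⟩ := NOD.exists_measure_abs_sum_ge_rpow_le μ hp0 hp' hq2 C B hε
    obtain ⟨K₂, hK₂, h₂⟩ := NOD.exists_measure_sum_abs_ge_le μ hp.le hp' hq2 C
    set E : ℕ → Set Ω := fun n => (⋃ θ ∈ T n, {ω | 2 * ε * (n : ℝ) ^ (1 / p) ≤
        |∑ j : Fin n, (W n j ω * H θ (X j ω) - ∫ ω', W n j ω' * H θ (X j ω') ∂μ)|}) ∪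
      {ω | (3 + C) * (n : ℝ) ≤ ∑ j, |W n j ω|} with hE
    have hμE : ∀ᶠ n : ℕ in atTop, μ (E n) ≤
        ENNReal.ofReal ((c * (4 * K₁) + 4 * K₂) * (n : ℝ) ^ (-(β - s * D))) := by
      filter_upwards [hC, eventually_gt_atTop 0, hrlim.eventually_le_const hr₀] with n hn hn0 hnr
      have hn1 : (1 : ℝ) ≤ n := by exact_mod_cast hn0
      have hnpos : (0 : ℝ) < n := by linarith
      have hcard := (hT n hn0 hnr).1
      have e1 : ∀ θ : Θ, μ {ω | 2 * ε * (n : ℝ) ^ (1 / p) ≤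
          |∑ j : Fin n, (W n j ω * H θ (X j ω) - ∫ ω', W n j ω' * H θ (X j ω') ∂μ)|} ≤
          ENNReal.ofReal (4 * K₁ * (n : ℝ) ^ (-β)) := fun θ =>
        h₁ n hn0 (W n) (fun j => X j) (hW_nod n) (hW_meas n) (fun j => hX_meas j) (hXi n)
          (hWXn n) hn (H θ) (hH_meas θ) fun j => hB θ j
      have e2 := h₂ n hn0 (W n) (fun j => X j) (hW_nod n) (hW_meas n) (fun j => hX_meas j) (hXi n)
        (hWXn n) hn
      calc μ (E n) ≤ (T n).card * ENNReal.ofReal (4 * K₁ * (n : ℝ) ^ (-β)) +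
            ENNReal.ofReal (4 * K₂ * (n : ℝ) ^ (-β)) := by
            refine (measure_union_le _ _).trans (add_le_add ?_ e2)
            refine (measure_biUnion_finset_le _ _).trans ?_
            refine (Finset.sum_le_sum fun θ _ => e1 θ).trans ?_
            rw [Finset.sum_const, nsmul_eq_mul]
        _ = ENNReal.ofReal ((T n).card * (4 * K₁ * (n : ℝ) ^ (-β)) +
              4 * K₂ * (n : ℝ) ^ (-β)) := by
            rw [ENNReal.ofReal_add (by positivity) (by positivity),
              ENNReal.ofReal_mul (Nat.cast_nonneg (T n).card), ENNReal.ofReal_natCast]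
        _ ≤ _ := by
            refine ENNReal.ofReal_le_ofReal ?_
            have h3 : (n : ℝ) ^ (-(β - s * D)) = (n : ℝ) ^ (s * D) * (n : ℝ) ^ (-β) := by
              rw [← Real.rpow_add hnpos]
              congr 1
              ring
            -- Lets the single bad event for ∑|W n j| be absorbed into the larger bound for the
            -- whole net.
            have h4 : (1 : ℝ) ≤ (n : ℝ) ^ (s * D) := Real.one_le_rpow hn1 (by positivity)
            calc (T n).card * (4 * K₁ * (n : ℝ) ^ (-β)) + 4 * K₂ * (n : ℝ) ^ (-β)
                ≤ c * (n : ℝ) ^ (s * D) * (4 * K₁ * (n : ℝ) ^ (-β)) +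
                  4 * K₂ * ((n : ℝ) ^ (s * D) * (n : ℝ) ^ (-β)) := by
                  gcongr
                  exact le_mul_of_one_le_left (by positivity) h4
              _ = _ := by rw [h3]; ring
    have hlim : Tendsto (fun n : ℕ => (3 + C + (1 + C)) * M * (n : ℝ) ^ (-(s * a - (1 - 1 / p))))
        atTop (𝓝 0) := by
      simpa using ((tendsto_rpow_neg_atTop (sub_pos.2 hsa)).comp
        tendsto_natCast_atTop_atTop).const_mul ((3 + C + (1 + C)) * M : ℝ)
    filter_upwards [ae_eventually_notMem_of_measure_le_rpow (by positivity)
      (by linarith : 1 < β - s * D) hμE] with ω hω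
    filter_upwards [hω, hC, eventually_gt_atTop 0, hrlim.eventually_le_const hr₀,
      hrlim.eventually_le_const hδ, hlim.eventually_le_const hε] with n hnE hn hn0 hnr hnδ hnε θ
    have hnpos : (0 : ℝ) < n := by exact_mod_cast hn0
    simp only [hE, Set.mem_union, Set.mem_iUnion, Set.mem_ofPred_eq, not_or, not_exists,
      not_le] at hnE
    obtain ⟨θ', hθ'T, hθ'⟩ := (hT n hn0 hnr).2 θ
    have h3 := hnE.1 θ' hθ'T
    have h4 := hnE.2
    obtain ⟨hWint, hWsum⟩ := sum_integral_abs_le μ hq1 (hW_meas n) hn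
    have h5 := abs_sum_sub_integral_le_of_abs_sub_le (μ := μ) (b := M * (n : ℝ) ^ (-(s * a)))
      (U := fun (j : Fin n) ω => H θ (X j ω)) (V := fun (j : Fin n) ω => H θ' (X j ω)) hWint
      (fun j => hint n hn j θ) (fun j => hint n hn j θ') (fun j ω' => by
        refine (hHol (X j ω') θ θ' (hθ'.trans_le hnδ)).trans ?_
        have : (n : ℝ) ^ (-(s * a)) = ((n : ℝ) ^ (-s)) ^ a := by
          rw [← Real.rpow_mul hnpos.le, neg_mul]
        rw [this]
        gcongr) ω
    have h6 : (∑ j, |W n j ω| + ∑ j, ∫ ω', |W n j ω'| ∂μ) * (M * (n : ℝ) ^ (-(s * a))) ≤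
        ε * (n : ℝ) ^ (1 / p) := by
      have h7 : (n : ℝ) * (n : ℝ) ^ (-(s * a)) =
          (n : ℝ) ^ (-(s * a - (1 - 1 / p))) * (n : ℝ) ^ (1 / p) := by
        rw [← Real.rpow_add hnpos]
        nth_rewrite 1 [← Real.rpow_one (n : ℝ)]
        rw [← Real.rpow_add hnpos]
        congr 1
        ring
      calc _ ≤ ((3 + C) * (n : ℝ) + (1 + C) * n) * (M * (n : ℝ) ^ (-(s * a))) := by gcongr
        _ = (3 + C + (1 + C)) * M * ((n : ℝ) * (n : ℝ) ^ (-(s * a))) := by ring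
        _ = (3 + C + (1 + C)) * M * (n : ℝ) ^ (-(s * a - (1 - 1 / p))) * (n : ℝ) ^ (1 / p) := by
            rw [h7]; ring
        _ ≤ _ := by gcongr
    have hnp : 0 < (n : ℝ) ^ (1 / p) := by positivity
    rw [abs_mul, abs_of_pos (by positivity), one_div, inv_mul_le_iff₀ hnp]
    linarith
  -- The null set in `key` depends on ε, so only the countably many values 1/(m + 1) are used.
  have hall : ∀ᵐ ω ∂μ, ∀ m : ℕ, ∀ᶠ n : ℕ in atTop, ∀ θ : Θ,
      |1 / (n : ℝ) ^ (1 / p) *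
          ∑ j : Fin n, (W n j ω * H θ (X j ω) - ∫ ω', W n j ω' * H θ (X j ω') ∂μ)| ≤
        3 * (1 / ((m : ℝ) + 1)) := ae_all_iff.2 fun m => key _ (by positivity)
  filter_upwards [hall] with ω hω
  rw [ENNReal.tendsto_nhds_zero]
  intro ε hε
  have hlim : Tendsto (fun m : ℕ => ENNReal.ofReal (3 * (1 / ((m : ℝ) + 1)))) atTop (𝓝 0) := by
    have := ENNReal.tendsto_ofReal
      ((tendsto_one_div_add_atTop_nhds_zero_nat (𝕜 := ℝ)).const_mul 3)
    simpa using this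
  obtain ⟨m, hm⟩ := (hlim.eventually_le_const hε).exists
  filter_upwards [hω m] with n hn
  exact iSup_le fun θ => (ENNReal.ofReal_le_ofReal (hn θ)).trans hm
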